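/- \textbf{Conventions.} Groups act on the right, $g^h=h^{-1}gh$. For a set with equivalence relation $(X,\sim)$ write $\overline{x}$ for the class of $x$, $\overline{X}$ for the set of classes, $\mathrm{Sym}(X,\sim)$ for the group of bijections $g$ of $X$ with $x\sim y\iff xg\sim yg$, and $\overline{g}$, $\overline{U}$ for the induced action on $\overline{X}$. A \emph{local Moufang set} $\mathbb{M}$ consists of $(X,\sim)$ with $|\overline{X}|>2$ and a subgroup $U_x\le\mathrm{Sym}(X,\sim)$ for every $x\in X$ such that, with $G=\langle U_x\mid x\in X\rangle$: $\overline{U_x}=\overline{U_y}$ whenever $x\sim y$; $U_x$ fixes $x$ and acts sharply transitively on $X\setminus\overline{x}$; $\overline{U_x}$ fixes $\overline{x}$ and acts sharply transitively on $\overline{X}\setminus\{\overline{x}\}$; $U_x^g=U_{xg}$ for all $x\in X$, $g\in G$. Two local Moufang sets $(X,(U_x))$, $(Y,(V_y))$ are \emph{isomorphic} if there is a bijection $\phi\colon X\to Y$ with $x\sim x'\iff x\phi\sim x'\phi$ and $U_x\phi\subseteq\phi V_{x\phi}$ for all $x,x'\in X$. Fix points $0\nsim\infty$ of $X$. For $x\nsim\infty$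 let $\alpha_x$ be the unique element of $U_\infty$ mapping $0$ to $x$, and put $-x=0\alpha_x^{-1}$, $x+y=0\alpha_x\alpha_y$, $x-y=x+(-y)$, $x\cdot 2=2x=0\alpha_x^2$. A \emph{unit} is a point $x$ with $x\nsim0$ and $x\nsim\infty$. For a unit $x$, $\mu_x$ is the unique element of $U_0\alpha_xU_0$ that interchanges $0$ and $\infty$. Fix $\tau=\mu_t$ for some unit $t$. Consider the conditions: (R1) $(-(x\tau^{-1}))\tau=-x$ for all units $x$; (R2) $U_\infty$ is abelian; (R3) the group $\langle\mu_x\mu_y\mid x,y\text{ units}\rangle$ is abelian; (R4) if $x$ is a unit, then so is $x\cdot 2$. Assume (R1)--(R4), let $e$ be a unit, put $h_x=\mu_e\mu_x$ for units $x$, and for $x,y\in R:=X\setminus\overline{\infty}$ let \[ xR_y=\begin{cases} xh_{e+y}-xh_y-x & \text{if $y$ and $y+e$ are units},\\ -xh_{-e+y}+x+xh_y & \text{if $y$ is a unit and $y+e$ is not},\\ xh_{2e+y}-xh_{e+y}-xh_{-2e}+x & \text{if $y$ is not a unit.} \end{cases} \] Put $xy:=xR_y\cdot\tfrac12$, where $z\cdot\tfrac12$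 is the unique element $w$ of $R$ with $w\cdot2=z$. For a commutative local ring $(S,\mathfrak m)$, let $\mathbb{P}^1(S)$ be the set of pairs $(a,b)\in S^2$ with $aS+bS=S$ modulo multiplication by $S^\times$, with $[a,b]\sim[c,d]\iff ad-bc\in\mathfrak m$. Let $\mathrm{PSL}_2(S)$ act on row vectors from the right, and let $U=\left\{\begin{bmatrix}1&r\\0&1\end{bmatrix}\;\middle|\;r\in S\right\}$ and $\tau'=\begin{bmatrix}0&-1\\1&0\end{bmatrix}$. The \emph{projective local Moufang set} $\mathbb{M}(S)$ has underlying set $(\mathbb{P}^1(S),\sim)$ and, with $\infty=[0,1]$ and $0=[1,0]=\infty\tau'$, the root groups $U_\infty=U$, $U_0=U^{\tau'}$, $U_x=U_0^{\alpha_x}$ for $x\nsim\infty$ and $U_x=U_\infty^{\gamma}$ with $\gamma=\alpha_{x\tau'^{-1}}^{\tau'}$ for $x\sim\infty$, where $\alpha_x\in U$ maps $0$ to $x$. \textbf{Theorem.} Let $\mathbb{M}$ be a local Moufang set satisfying (R1)--(R4), let $e$, $R$ and $R_x$ be as above, and assume \[ x\mu_e\alpha_y = yR_x\,\alpha_{-2e}\,\mu_e\,R_x\,\mu_e\quad\text{for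 all $x\sim0$ and $y\nsim\infty$.}\tag{$\star$} \] Then $R$ with the above addition and multiplication is a commutative local ring with zero $0$ and identity $e$, $\mathbb{M}(R)$ is a local Moufang set, and $\mathbb{M}$ is isomorphic to $\mathbb{M}(R)$. -/

import Mathlib

open scoped MatrixGroups

universe u

noncomputable section

namespace LocalMoufang

/-! Groups act on the right in the mathematics, on the left in Lean: the right action `x g` is
written `g • x`, a product `g h` (first `g`, then `h`) is `h * g`, and the conjugate
`g ^ h = h⁻¹ g h` is `h * g * h⁻¹ = MulAut.conj h g`. -/

/-- `Sym(X, ∼)`: the bijections of `X` that preserve the equivalence relation `r`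
(in both directions). -/
def SymRel {X : Type u} (r : Setoid X) : Subgroup (Equiv.Perm X) where
  carrier := {g | ∀ x y, r x y ↔ r (g x) (g y)}
  mul_mem' := by
    intro a b ha hb x y
    exact (hb x y).trans (ha (b x) (b y))
  one_mem' := fun _ _ => Iff.rfl
  inv_mem' := by
    intro a ha x y
    have h := ha (a⁻¹ x) (a⁻¹ y)
    simpa using h.symm

/-- The action induced by `Sym(X, ∼)` on the set of equivalence classes. -/
def induced {X : Type u} (r : Setoid X) : SymRel r →* Equiv.Perm (Quotient r) where
  toFun g := Quotient.congr g.1 g.2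
  map_one' := by
    ext q
    induction q using Quotient.inductionOn with
    | h x => rfl
  map_mul' a b := by
    ext q
    induction q using Quotient.inductionOn with
    | h x => rfl

/-- The conjugate subgroup `H ^ g = g⁻¹ H g` (for right actions). -/
def conjBy {G : Type u} [Group G] (H : Subgroup G) (g : G) : Subgroup G :=
  H.map (MulAut.conj g).toMonoidHom

/-- The elements of `H` act sharply transitively on the set `S`. -/
def SharplyTransitiveOn {G Y : Type u} [Group G] [MulAction G Y] (H : Subgroup G)
    (S : Set Y) : Prop :=
  ∀ y ∈ S, ∀ z ∈ S, ∃! g : G, g ∈ H ∧ g • y = z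

/-- The data of a local Moufang set: an equivalence relation on `X` and, for each point, a
subgroup of `Sym(X, ∼)`. -/
structure Data (X : Type u) where
  rel : Setoid X
  U : X → Subgroup (SymRel rel)

namespace Data

variable {X : Type u} (M : Data X)

/-- The little projective group. -/
def G : Subgroup (SymRel M.rel) := ⨆ x, M.U x

/-- The permutation group induced by the root group `U x` on the set of classes. -/
def Ubar (x : X) : Subgroup (Equiv.Perm (Quotient M.rel)) := (M.U x).map (induced M.rel)

/-- The data form a local Moufang set. -/
structure IsLocalMoufangSet : Prop where
  two_lt_card : 2 < Cardinal.mk (Quotient M.rel)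
  LM0 : ∀ x y, M.rel x y → M.Ubar x = M.Ubar y
  LM1_fix : ∀ x, ∀ g ∈ M.U x, g • x = x
  LM1 : ∀ x, SharplyTransitiveOn (M.U x) {y | ¬ M.rel y x}
  LM1'_fix : ∀ x, ∀ g ∈ M.Ubar x, g • (Quotient.mk M.rel x) = Quotient.mk M.rel x
  LM1' : ∀ x, SharplyTransitiveOn (M.Ubar x) {q | q ≠ Quotient.mk M.rel x}
  LM2 : ∀ x, ∀ g ∈ M.G, conjBy (M.U x) g = M.U (g • x)

end Data

/-- For a group `U` of permutations and points `o`, `x`: the element of `U` mapping `o` to `x`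
(it is only used where it exists and is unique). -/
def alphaOf {X : Type u} {r : Setoid X} (U : Subgroup (SymRel r)) (o x : X) : SymRel r :=
  open Classical in
  if h : ∃ g : SymRel r, g ∈ U ∧ g • o = x then h.choose else 1

namespace Data

/-! Below, `(o, i)` is a basis: `o` plays the role of `0` and `i` that of `∞`. -/

variable {X : Type u} (M : Data X) (o i : X)

/-- `α_x`, the element of `U_∞` mapping `0` to `x`, for `x ≁ ∞`. -/
def alpha (x : X) : SymRel M.rel := alphaOf (M.U i) o x

/-- `-x = 0 · α_x⁻¹`. -/
def neg (x : X) : X := (M.alpha o i x)⁻¹ • o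

/-- `x + y = 0 · α_x α_y`. -/
def add (x y : X) : X := (M.alpha o i y * M.alpha o i x) • o

/-- `x - y = x + (-y)`. -/
def sub (x y : X) : X := M.add o i x (M.neg o i y)

/-- `x · k = 0 · α_x ^ k`. -/
def times (x : X) (k : ℕ) : X := (M.alpha o i x ^ k) • o

/-- `x` is a unit with respect to the basis `(o, i)`. -/
def IsUnitPt (x : X) : Prop := ¬ M.rel x o ∧ ¬ M.rel x i

/-- `m` lies in the double coset `U_0 α_x U_0` and swaps `0` and `∞`. -/
def IsMu (x : X) (m : SymRel M.rel) : Prop :=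
  (∃ g ∈ M.U o, ∃ h ∈ M.U o, m = h * M.alpha o i x * g) ∧ m • o = i ∧ m • i = o

/-- The `μ`-map `μ_x`: the element of `U_0 α_x U_0` swapping `0` and `∞`, for a unit `x`
(for which it exists and is unique in a local Moufang set). -/
def mu (x : X) : SymRel M.rel :=
  open Classical in
  if h : ∃ m, M.IsMu o i x m then h.choose else 1

/-- `∼x = (-(x τ⁻¹)) τ`. -/
def tilde (τ : SymRel M.rel) (x : X) : X := τ • M.neg o i (τ⁻¹ • x)

/-- The Hua map `h_{x,τ} = τ μ_x`. -/
def hua (τ : SymRel M.rel) (x : X) : SymRel M.rel := M.mu o i x * τ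

/-- The Hua subgroup, generated by the products `μ_x μ_y` for units `x`, `y`. -/
def huaSubgroup : Subgroup (SymRel M.rel) :=
  Subgroup.closure
    {g | ∃ x y, M.IsUnitPt o i x ∧ M.IsUnitPt o i y ∧ g = M.mu o i y * M.mu o i x}

/-- The conditions (R1)-(R4), with respect to a basis `(o, i)` and a `μ`-map `τ`. -/
structure SatisfiesR (τ : SymRel M.rel) : Prop where
  R1 : ∀ x, M.IsUnitPt o i x → M.tilde o i τ x = M.neg o i x
  R2 : ∀ a ∈ M.U i, ∀ b ∈ M.U i, a * b = b * a
  R3 : ∀ a ∈ M.huaSubgroup o i, ∀ b ∈ M.huaSubgroup o i, a * b = b * a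
  R4 : ∀ x, M.IsUnitPt o i x → M.IsUnitPt o i (M.times o i x 2)

/-- `x R_y`, where `e` is a unit and `h_z = μ_e μ_z`. -/
def Rmap (e y x : X) : X :=
  let h : X → X → X := fun z w => M.hua o i (M.mu o i e) z • w
  let e2 : X := M.times o i e 2
  open Classical in
  if M.IsUnitPt o i y then
    if M.IsUnitPt o i (M.add o i y e) then
      M.sub o i (M.sub o i (h (M.add o i e y) x) (h y x)) x
    else
      M.add o i (M.add o i (M.neg o i (h (M.add o i (M.neg o i e) y) x)) x) (h y x)
  else
    M.add o i
      (M.sub o i (M.sub o i (h (M.add o i e2 y) x) (h (M.add o i e y) x)) (h (M.neg o i e2) x)) x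

/-- `x · (1/2)`: the point `z ≁ ∞` with `z · 2 = x` (used where it exists and is unique). -/
def half (x : X) : X :=
  open Classical in
  if h : ∃ z, ¬ M.rel z i ∧ M.times o i z 2 = x then h.choose else x

/-- The product `x y = x R_y · (1/2)`. -/
def mul (e x y : X) : X := M.half o i (M.Rmap o i e y x)

/-- The underlying set `X ∖ [∞]` of the ring constructed from `M`. -/
def RingCarrier : Type u := {x : X // ¬ M.rel x i}

/-- The identity `x μ_e α_y = y R_x α_{-2e} μ_e R_x μ_e` for all `x ∼ 0` and `y ≁ ∞`. -/
def StarIdentity (e : X) : Prop :=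
  ∀ x y, M.rel x o → ¬ M.rel y i →
    M.alpha o i y • M.mu o i e • x =
      M.mu o i e • M.Rmap o i e x
        (M.mu o i e • M.alpha o i (M.neg o i (M.times o i e 2)) • M.Rmap o i e x y)

/-- A commutative ring structure on `X ∖ [∞]` is the constructed one: its operations are
`x + y = 0 · α_x α_y` and `x y = x R_y · (1/2)`, with zero `0` and identity `e`. -/
structure IsConstructedRing (e : X) [CommRing (M.RingCarrier i)] : Prop where
  add_eq : ∀ x y : M.RingCarrier i, (x + y).1 = M.add o i x.1 y.1
  mul_eq : ∀ x y : M.RingCarrier i, (x * y).1 = M.mul o i e x.1 y.1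
  zero_eq : (0 : M.RingCarrier i).1 = o
  one_eq : (1 : M.RingCarrier i).1 = e

end Data

/-- A homomorphism: `x ∼ x' ↔ x φ ∼ x' φ` and `U_x φ ⊆ φ V_{x φ}`. -/
structure IsHom {X Y : Type u} (M : Data X) (N : Data Y) (φ : X → Y) : Prop where
  rel_iff : ∀ x x', M.rel x x' ↔ N.rel (φ x) (φ x')
  map_root : ∀ x, ∀ g ∈ M.U x, ∃ v ∈ N.U (φ x), ∀ y, φ (g • y) = v • φ y

/-- Isomorphic: there is a bijective homomorphism. -/
def Isomorphic {X Y : Type u} (M : Data X) (N : Data Y) : Prop :=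
  ∃ φ : X → Y, Function.Bijective φ ∧ IsHom M N φ

/-- The construction `𝕄(U, τ)`, where `U` fixes `i` (that is, `∞`) and `0 = ∞ τ`: with
`U_∞ = U`, `U_0 = U ^ τ` and `γ_x = α_x ^ τ`, one puts `U_x = U_0 ^ α_x` for `x ≁ ∞` and
`U_x = U_∞ ^ γ_{x τ⁻¹}` for `x ∼ ∞`. -/
def construct {X : Type u} (r : Setoid X) (U : Subgroup (SymRel r)) (τ : SymRel r) (i : X) :
    Data X where
  rel := r
  U x :=
    open Classical in
    if r x i then conjBy U (τ * alphaOf U (τ • i) (τ⁻¹ • x) * τ⁻¹)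
    else conjBy (conjBy U τ) (alphaOf U (τ • i) x)

/-! The projective line over a commutative ring and its local Moufang set. -/

section Projective

variable (R : Type u) [CommRing R]

/-- Pairs `(a, b)` with `aR + bR = R`. -/
def UnimodularPair : Type u := {v : Fin 2 → R // IsCoprime (v 0) (v 1)}

/-- Two pairs are proportional by an invertible element. -/
def unitSetoid : Setoid (UnimodularPair R) where
  r v w := ∃ c : Rˣ, w.1 = (c : R) • v.1
  iseqv := by
    refine ⟨fun v => ⟨1, by simp⟩, ?_, ?_⟩
    · rintro v w ⟨c, hc⟩
      exact ⟨c⁻¹, by rw [hc, smul_smul]; simp⟩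
    · rintro v w z ⟨c, hc⟩ ⟨d, hd⟩
      exact ⟨d * c, by rw [hd, hc, smul_smul]; simp⟩

/-- The projective line `ℙ¹(R)`. -/
def P1 : Type u := Quotient (unitSetoid R)

variable {R}

/-- The point `[a, b]`. -/
def P1.mk (a b : R) (h : IsCoprime a b) : P1 R :=
  Quotient.mk (unitSetoid R) ⟨![a, b], by simpa using h⟩

/-- The right action of `SL₂(R)` on `ℙ¹(R)`, row vectors times matrices. -/
def slMap (A : SL(2, R)) : P1 R → P1 R :=
  Quotient.map
    (fun v : UnimodularPair R =>
      (⟨Matrix.vecMul v.1 A.1, v.2.vecMulSL A⟩ : UnimodularPair R))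
    (by
      rintro v w ⟨c, hc⟩
      exact ⟨c, by simp only [hc, Matrix.smul_vecMul]⟩)

theorem slMap_one (p : P1 R) : slMap (1 : SL(2, R)) p = p := by
  induction p using Quotient.inductionOn with
  | h v =>
    apply Quotient.sound
    exact ⟨1, by simp⟩

theorem slMap_mul (A B : SL(2, R)) (p : P1 R) : slMap (A * B) p = slMap B (slMap A p) := by
  induction p using Quotient.inductionOn with
  | h v =>
    apply Quotient.sound
    exact ⟨1, by simp [Matrix.vecMul_vecMul]⟩

variable (R) [IsLocalRing R]

/-- The equivalence on `ℙ¹(R)`: `[a, b] ∼ [c, d]` if and only if `ad - bc` lies in the maximal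
ideal, that is, the two points have the same reduction over the residue field. The three theorems
below make it explicit on the representatives `[1, r]` and `[m, 1]`. -/
def P1.rel : Setoid (P1 R) where
  r p q := Quotient.liftOn₂ p q
    (fun v w => v.1 0 * w.1 1 - v.1 1 * w.1 0 ∈ IsLocalRing.maximalIdeal R)
    (by
      rintro v w v' w' ⟨c, hc⟩ ⟨d, hd⟩
      apply propext
      have : v'.1 0 * w'.1 1 - v'.1 1 * w'.1 0
          = ((c * d : Rˣ) : R) * (v.1 0 * w.1 1 - v.1 1 * w.1 0) := by
        simp only [hc, hd, Pi.smul_apply, smul_eq_mul, Units.val_mul]; ring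
      rw [this]
      exact (Ideal.unit_mul_mem_iff_mem _ (Units.isUnit _)).symm)
  iseqv := by
    refine ⟨?_, ?_, ?_⟩
    · intro p
      induction p using Quotient.inductionOn with
      | h v =>
        change v.1 0 * v.1 1 - v.1 1 * v.1 0 ∈ _
        have : v.1 0 * v.1 1 - v.1 1 * v.1 0 = 0 := by ring
        rw [this]; exact zero_mem _
    · intro p q
      induction p, q using Quotient.inductionOn₂ with
      | h v w =>
        intro h
        change v.1 0 * w.1 1 - v.1 1 * w.1 0 ∈ _ at h
        change w.1 0 * v.1 1 - w.1 1 * v.1 0 ∈ _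
        have : w.1 0 * v.1 1 - w.1 1 * v.1 0 = -(v.1 0 * w.1 1 - v.1 1 * w.1 0) := by ring
        rw [this]; exact neg_mem h
    · intro p q s
      induction p, q, s using Quotient.inductionOn₃ with
      | h v w z =>
        intro h1 h2
        change v.1 0 * w.1 1 - v.1 1 * w.1 0 ∈ _ at h1
        change w.1 0 * z.1 1 - w.1 1 * z.1 0 ∈ _ at h2
        change v.1 0 * z.1 1 - v.1 1 * z.1 0 ∈ _
        obtain ⟨a, b, hab⟩ := w.2
        have : v.1 0 * z.1 1 - v.1 1 * z.1 0
            = (a * v.1 0 + b * v.1 1) * (w.1 0 * z.1 1 - w.1 1 * z.1 0)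
              + (a * z.1 0 + b * z.1 1) * (v.1 0 * w.1 1 - v.1 1 * w.1 0) := by
          linear_combination (-(v.1 0 * z.1 1 - v.1 1 * z.1 0)) * hab
        rw [this]
        exact add_mem (Ideal.mul_mem_left _ _ h2) (Ideal.mul_mem_left _ _ h1)

variable {R}

theorem P1.rel_affine (r s : R) :
    P1.rel R (P1.mk 1 r isCoprime_one_left) (P1.mk 1 s isCoprime_one_left) ↔
      r - s ∈ IsLocalRing.maximalIdeal R := by
  change (1 : R) * s - r * 1 ∈ IsLocalRing.maximalIdeal R ↔ _
  have : (1 : R) * s - r * 1 = -(r - s) := by ring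
  rw [this, neg_mem_iff]

theorem P1.rel_infinity (m n : R) (hm : m ∈ IsLocalRing.maximalIdeal R)
    (hn : n ∈ IsLocalRing.maximalIdeal R) :
    P1.rel R (P1.mk m 1 isCoprime_one_right) (P1.mk n 1 isCoprime_one_right) := by
  change m * 1 - 1 * n ∈ IsLocalRing.maximalIdeal R
  simpa using sub_mem hm hn

theorem P1.not_rel (m r : R) (hm : m ∈ IsLocalRing.maximalIdeal R) :
    ¬ P1.rel R (P1.mk m 1 isCoprime_one_right) (P1.mk 1 r isCoprime_one_left) := by
  change ¬ (m * r - 1 * 1 ∈ IsLocalRing.maximalIdeal R)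
  intro h
  apply (Ideal.ne_top_iff_one _).1 (IsLocalRing.maximalIdeal.isMaximal R).ne_top
  simpa using sub_mem (Ideal.mul_mem_right r _ hm) h

theorem slMap_rel (A : SL(2, R)) (p q : P1 R) :
    P1.rel R p q ↔ P1.rel R (slMap A p) (slMap A q) := by
  induction p, q using Quotient.inductionOn₂ with
  | h v w =>
    change v.1 0 * w.1 1 - v.1 1 * w.1 0 ∈ IsLocalRing.maximalIdeal R ↔
      Matrix.vecMul v.1 A.1 0 * Matrix.vecMul w.1 A.1 1
        - Matrix.vecMul v.1 A.1 1 * Matrix.vecMul w.1 A.1 0 ∈ IsLocalRing.maximalIdeal R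
    have hdet := A.2
    rw [Matrix.det_fin_two] at hdet
    have : Matrix.vecMul v.1 A.1 0 * Matrix.vecMul w.1 A.1 1
        - Matrix.vecMul v.1 A.1 1 * Matrix.vecMul w.1 A.1 0
        = v.1 0 * w.1 1 - v.1 1 * w.1 0 := by
      simp only [Matrix.vecMul, dotProduct, Fin.sum_univ_two]
      linear_combination (v.1 0 * w.1 1 - v.1 1 * w.1 0) * hdet
    rw [this]

/-- The right action of `SL₂(R)` on `(ℙ¹(R), ∼)`; a right action is a homomorphism to the opposite
of the group of permutations. -/
def slHom : SL(2, R) →* (SymRel (P1.rel R))ᵐᵒᵖ where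
  toFun A := MulOpposite.op
    ⟨{ toFun := slMap A
       invFun := slMap A⁻¹
       left_inv := fun p => by rw [← slMap_mul, mul_inv_cancel, slMap_one]
       right_inv := fun p => by rw [← slMap_mul, inv_mul_cancel, slMap_one] },
     slMap_rel A⟩
  map_one' := by
    apply MulOpposite.unop_injective
    apply Subtype.ext
    ext p
    exact slMap_one p
  map_mul' A B := by
    apply MulOpposite.unop_injective
    apply Subtype.ext
    ext p
    exact slMap_mul A B p

theorem center_le_ker_slHom : Subgroup.center SL(2, R) ≤ (slHom (R := R)).ker := by
  intro A hA
  obtain ⟨c, hc, hA⟩ := Matrix.SpecialLinearGroup.mem_center_iff.1 hA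
  rw [MonoidHom.mem_ker]
  apply MulOpposite.unop_injective
  apply Subtype.ext
  ext p
  induction p using Quotient.inductionOn with
  | h v =>
    have hc2 : c * c = 1 := by simpa [pow_two] using hc
    refine Quotient.sound (s := unitSetoid R) ⟨Units.mk c c hc2 hc2, ?_⟩
    change v.1 = c • Matrix.vecMul v.1 A.1
    rw [← hA]
    ext j
    simp [Matrix.scalar_apply]
    linear_combination (-(v.1 j)) * hc2

/-- The right action of `PSL₂(R)` on `(ℙ¹(R), ∼)`. -/
def pslHom : PSL(2, R) →* (SymRel (P1.rel R))ᵐᵒᵖ :=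
  QuotientGroup.lift _ slHom center_le_ker_slHom

/-- The matrix `(1 r; 0 1)`. -/
def upperMatrix (r : R) : SL(2, R) := ⟨!![1, r; 0, 1], by simp⟩

variable (R) in
/-- The matrix `(0 -1; 1 0)`. -/
def tauMatrix : SL(2, R) := ⟨!![0, -1; 1, 0], by simp⟩

variable (R) in
/-- The group `U` of the elements of `PSL₂(R)` represented by `(1 r; 0 1)`. -/
def upper : Subgroup PSL(2, R) where
  carrier := {g | ∃ r : R, g = QuotientGroup.mk (upperMatrix r)}
  one_mem' := ⟨0, by
    rw [← QuotientGroup.mk_one]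
    congr 1
    ext j k
    fin_cases j <;> fin_cases k <;> simp [upperMatrix]⟩
  mul_mem' := by
    rintro _ _ ⟨r, rfl⟩ ⟨s, rfl⟩
    refine ⟨s + r, ?_⟩
    rw [← QuotientGroup.mk_mul]
    congr 1
    ext j k
    rw [Matrix.SpecialLinearGroup.coe_mul]
    fin_cases j <;> fin_cases k <;> simp [upperMatrix]
  inv_mem' := by
    rintro _ ⟨r, rfl⟩
    refine ⟨-r, ?_⟩
    rw [← QuotientGroup.mk_inv]
    congr 1
    ext j k
    rw [Matrix.SpecialLinearGroup.coe_inv, Matrix.adjugate_fin_two]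
    fin_cases j <;> fin_cases k <;> simp [upperMatrix]

variable (R) in
/-- The element `τ` of `PSL₂(R)` represented by `(0 -1; 1 0)`. -/
def projTau : PSL(2, R) := QuotientGroup.mk (tauMatrix R)

variable (R) in
/-- The projective local Moufang set `𝕄(R) = 𝕄(U, τ)` on `ℙ¹(R)`, with `∞ = [0, 1]`. -/
def projective : Data (P1 R) :=
  construct (P1.rel R) ((upper R).map pslHom).unop (pslHom (projTau R)).unop
    (P1.mk 0 1 isCoprime_one_right)

end Projective

end LocalMoufang

end

/-!
By (R1), the `μ`-maps satisfy `μ_x = α_x β_x⁻¹ α_x` and `μ_{-x} = μ_x⁻¹`. This yields a formula for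
the action of `μ_{a+b}`, and makes doubling bijective on `R`. An element of the torus that fixes
enough points is trivial, so that (R3) forces `μ_b² = 1`. The maps `R_y` lie in the commutative ring
generated by the Hua maps and send `e` to `2y`; since `R_x` and `R_y` commute, `x R_y · (1/2)` is
a commutative and associative product, and `a μ_e = -a⁻¹` for units `a`. Finally `x ↦ [1, x]`,
`x μ_e ↦ [x, -1]` identifies `X` with `ℙ¹(R)` and intertwines `μ_e` with `τ'`; the identity (⋆)
says that it also intertwines `α_y` with the translation by `y`, on the class of `∞`. Since `U_∞`
and `μ_e` determine all root groups, this bijection is an isomorphism.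
-/

noncomputable section

namespace LocalMoufang

section SymmetryGroups

variable {X Y : Type u} {r : Setoid X} {s : Setoid Y}

theorem rel_smul_smul_iff (g : SymRel r) (x y : X) : r (g • x) (g • y) ↔ r x y :=
  (g.2 x y).symm

theorem rel_smul_iff_of_smul_eq {g : SymRel r} {y z : X} (h : g • y = z) (x : X) :
    r (g • x) z ↔ r x y := by
  rw [← h, rel_smul_smul_iff]

/-- The isomorphism of symmetry groups induced by a bijection that preserves the relations. -/
def symEquiv (φ : X ≃ Y) (h : ∀ x x', r x x' ↔ s (φ x) (φ x')) : SymRel r ≃* SymRel s where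
  toFun g := ⟨φ.permCongr g.1, fun x y => by
    simpa using (h _ _).symm.trans ((g.2 (φ.symm x) (φ.symm y)).trans (h _ _))⟩
  invFun g := ⟨φ.symm.permCongr g.1, fun x y => by
    simpa [h] using g.2 (φ x) (φ y)⟩
  left_inv g := by ext x; simp
  right_inv g := by ext x; simp
  map_mul' g g' := by ext x; simp

theorem symEquiv_smul (φ : X ≃ Y) (h : ∀ x x', r x x' ↔ s (φ x) (φ x')) (g : SymRel r) (x : X) :
    symEquiv φ h g • φ x = φ (g • x) :=
  congrArg (fun y => φ (g • y)) (φ.symm_apply_apply x)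

theorem alphaOf_mem_and_smul {U : Subgroup (SymRel r)} {x y : X}
    (h : ∃ g ∈ U, g • x = y) : alphaOf U x y ∈ U ∧ alphaOf U x y • x = y := by
  rw [alphaOf, dif_pos h]
  exact h.choose_spec

end SymmetryGroups

section Conjugation

variable {G G' : Type u} [Group G] [Group G']

theorem mem_conjBy_iff {H : Subgroup G} {g k : G} : k ∈ conjBy H g ↔ g⁻¹ * k * g ∈ H := by
  constructor
  · rintro ⟨k, hk, rfl⟩
    simpa [mul_assoc] using hk
  · exact fun h => ⟨_, h, by simp [mul_assoc]⟩

theorem conjBy_conjBy (H : Subgroup G) (g h : G) :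
    conjBy (conjBy H g) h = conjBy H (h * g) := by
  ext k
  simp only [mem_conjBy_iff, mul_inv_rev, mul_assoc]

theorem conjBy_eq_self_of_mem {H : Subgroup G} {g : G} (hg : g ∈ H) : conjBy H g = H := by
  ext k
  rw [mem_conjBy_iff, H.mul_mem_cancel_right hg, H.mul_mem_cancel_left (inv_mem hg)]

theorem map_conjBy (f : G →* G') (H : Subgroup G) (g : G) :
    (conjBy H g).map f = conjBy (H.map f) (f g) := by
  rw [conjBy, conjBy, Subgroup.map_map, Subgroup.map_map]
  congr 1
  ext k
  simp

theorem SharplyTransitiveOn.conjBy {Y : Type u} [MulAction G Y] {H : Subgroup G} {S : Set Y}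
    (hS : SharplyTransitiveOn H S) (g : G) :
    SharplyTransitiveOn (conjBy H g) {y | g⁻¹ • y ∈ S} := by
  intro y hy z hz
  obtain ⟨k, ⟨hk, hky⟩, k_unique⟩ := hS _ hy _ hz
  refine ⟨g * k * g⁻¹, ⟨⟨k, hk, rfl⟩, by simp [mul_smul, hky]⟩, fun k' ⟨hk', hk'y⟩ => ?_⟩
  rw [← k_unique _ ⟨mem_conjBy_iff.1 hk', by simp [mul_smul, hk'y]⟩]
  group

end Conjugation

namespace Data.IsLocalMoufangSet

variable {X : Type u} {M : Data X} {x y z i : X}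

theorem rel_smul_iff_of_mem (hM : M.IsLocalMoufangSet) {g : SymRel M.rel} (hg : g ∈ M.U x)
    (y : X) : M.rel (g • y) x ↔ M.rel y x :=
  rel_smul_iff_of_smul_eq (hM.LM1_fix x g hg) y

theorem root_ext (hM : M.IsLocalMoufangSet) {g h : SymRel M.rel} (hg : g ∈ M.U x)
    (hh : h ∈ M.U x) (hy : ¬ M.rel y x) (hgh : g • y = h • y) : g = h :=
  (hM.LM1 x y hy _ ((hM.rel_smul_iff_of_mem hg y).not.2 hy)).unique ⟨hg, rfl⟩ ⟨hh, hgh.symm⟩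

theorem exists_root (hM : M.IsLocalMoufangSet) (hy : ¬ M.rel y x) (hz : ¬ M.rel z x) :
    ∃ g ∈ M.U x, g • y = z :=
  (hM.LM1 x y hy z hz).exists

theorem alphaOf_mem (hM : M.IsLocalMoufangSet) (hy : ¬ M.rel y x) (hz : ¬ M.rel z x) :
    alphaOf (M.U x) y z ∈ M.U x :=
  (alphaOf_mem_and_smul (hM.exists_root hy hz)).1

theorem alphaOf_smul (hM : M.IsLocalMoufangSet) (hy : ¬ M.rel y x) (hz : ¬ M.rel z x) :
    alphaOf (M.U x) y z • y = z :=
  (alphaOf_mem_and_smul (hM.exists_root hy hz)).2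

theorem conj_mem (hM : M.IsLocalMoufangSet) {g u : SymRel M.rel} (hg : g ∈ M.G)
    (hu : u ∈ M.U x) : g * u * g⁻¹ ∈ M.U (g • x) := by
  rw [← hM.LM2 x g hg]
  exact ⟨u, hu, rfl⟩

theorem exists_root_smul_eq (hM : M.IsLocalMoufangSet) {g : SymRel M.rel}
    (hg : ¬ M.rel (g • i) i) (x : X) : ∃ a ∈ M.U i, a • g • i = x ∨ g • a • g • i = x := by
  by_cases hx : M.rel x i
  · have hx' : ¬ M.rel (g⁻¹ • x) i := by
      rw [← rel_smul_smul_iff g, smul_inv_smul]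
      exact fun h => hg (M.rel.trans' (M.rel.symm' h) hx)
    obtain ⟨a, ha, hax⟩ := hM.exists_root hg hx'
    exact ⟨a, ha, Or.inr (by rw [hax, smul_inv_smul])⟩
  · obtain ⟨a, ha, hax⟩ := hM.exists_root hg hx
    exact ⟨a, ha, Or.inl hax⟩

end Data.IsLocalMoufangSet

theorem Data.root_le_G {X : Type u} (M : Data X) (x : X) : M.U x ≤ M.G := le_iSup M.U x

theorem Data.isLocalMoufangSet_of_transitive {X : Type u} {N : Data X}
    {H : Subgroup (SymRel N.rel)} {i : X} (hcard : 2 < Cardinal.mk (Quotient N.rel))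
    (htrans : ∀ x, ∃ g ∈ H, g • i = x)
    (hconj : ∀ g ∈ H, ∀ x, conjBy (N.U x) g = N.U (g • x)) (hle : N.U i ≤ H)
    (hfix : ∀ g ∈ N.U i, g • i = i)
    (hsharp : SharplyTransitiveOn (N.U i) {y | ¬ N.rel y i})
    (hsharp' : SharplyTransitiveOn (N.Ubar i) {q | q ≠ Quotient.mk N.rel i})
    (hbar : ∀ x, N.rel x i → N.Ubar x = N.Ubar i) : N.IsLocalMoufangSet := by
  have hconj' : ∀ g ∈ H, ∀ x, N.Ubar (g • x) = conjBy (N.Ubar x) (induced N.rel g) := by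
    intro g hg x
    rw [Data.Ubar, ← hconj g hg, map_conjBy, Data.Ubar]
  have hG : N.G ≤ H := by
    refine iSup_le fun x => ?_
    obtain ⟨g, hg, rfl⟩ := htrans x
    rw [← hconj g hg]
    rintro _ ⟨k, hk, rfl⟩
    exact mul_mem (mul_mem hg (hle hk)) (inv_mem hg)
  have fix : ∀ x, ∀ g ∈ N.U x, g • x = x := by
    intro x k hk
    obtain ⟨g, hg, rfl⟩ := htrans x
    rw [← hconj g hg, mem_conjBy_iff] at hk
    simpa [mul_smul, inv_smul_eq_iff] using hfix _ hk
  refine ⟨hcard, fun x y hxy => ?_, fix, fun x => ?_, ?_, fun x => ?_,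
    fun x g hg => hconj g (hG hg) x⟩
  · obtain ⟨g, hg, rfl⟩ := htrans x
    have hy : N.rel (g⁻¹ • y) i := by
      rw [← rel_smul_smul_iff g, smul_inv_smul]
      exact N.rel.symm' hxy
    rw [hconj' g hg, ← hbar _ hy, ← hconj' g hg, smul_inv_smul]
  · obtain ⟨g, hg, rfl⟩ := htrans x
    rw [← hconj g hg]
    convert hsharp.conjBy g using 1
    ext y
    rw [Set.mem_ofPred_eq, Set.mem_ofPred_eq, Set.mem_ofPred_eq, ← rel_smul_smul_iff g⁻¹,
      inv_smul_smul]
  · rintro x _ ⟨k, hk, rfl⟩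
    exact congrArg (Quotient.mk N.rel) (fix x k hk)
  · obtain ⟨g, hg, rfl⟩ := htrans x
    rw [hconj' g hg]
    convert hsharp'.conjBy (induced N.rel g) using 1
    ext q
    exact (@inv_smul_eq_iff _ _ _ _ (induced N.rel g) q (Quotient.mk N.rel i)).symm.not

theorem isomorphic_of_map_root {X Y : Type u} {M : Data X} {N : Data Y}
    (hM : M.IsLocalMoufangSet) (hN : N.IsLocalMoufangSet) (φ : X ≃ Y)
    (hφ : ∀ x x', M.rel x x' ↔ N.rel (φ x) (φ x')) {i : X}
    (hU : (M.U i).map (symEquiv φ hφ).toMonoidHom = N.U (φ i)) {g : SymRel M.rel} (hg : g ∈ M.G)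
    (hgi : ¬ M.rel (g • i) i)
    (hconj : ∀ y, conjBy (N.U y) (symEquiv φ hφ g) = N.U (symEquiv φ hφ g • y)) :
    Isomorphic M N := by
  have hmap_smul {k : SymRel M.rel} (hk : k ∈ M.G)
      (hconj : ∀ y, conjBy (N.U y) (symEquiv φ hφ k) = N.U (symEquiv φ hφ k • y)) {x : X}
      (hx : (M.U x).map (symEquiv φ hφ).toMonoidHom = N.U (φ x)) :
      (M.U (k • x)).map (symEquiv φ hφ).toMonoidHom = N.U (φ (k • x)) := by
    rw [← hM.LM2 x k hk, map_conjBy, hx, ← symEquiv_smul φ hφ, ← hconj]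
    rfl
  have hmap_smul_root {a : SymRel M.rel} (ha : a ∈ M.U i) {x : X} :=
    hmap_smul (x := x) (M.root_le_G i ha) fun y =>
      hN.LM2 y _ (N.root_le_G _ (hU ▸ Subgroup.mem_map_of_mem (symEquiv φ hφ).toMonoidHom ha))
  refine ⟨φ, φ.bijective, hφ, fun x k hk => ⟨symEquiv φ hφ k, ?_, fun y =>
    (symEquiv_smul φ hφ k y).symm⟩⟩
  suffices hx : (M.U x).map (symEquiv φ hφ).toMonoidHom = N.U (φ x) from
    hx ▸ Subgroup.mem_map_of_mem (symEquiv φ hφ).toMonoidHom hk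
  obtain ⟨a, ha, rfl | rfl⟩ := hM.exists_root_smul_eq hgi x
  · exact hmap_smul_root ha (hmap_smul hg hconj hU)
  · exact hmap_smul hg hconj (hmap_smul_root ha (hmap_smul hg hconj hU))

section ProjectiveLine

variable {R : Type u} [CommRing R]

theorem P1.mk_eq_mk_iff {a b c d : R} (h : IsCoprime a b) (h' : IsCoprime c d) :
    P1.mk a b h = P1.mk c d h' ↔ ∃ u : Rˣ, c = u * a ∧ d = u * b := by
  refine Quotient.eq.trans (exists_congr fun u => ?_)
  change ![c, d] = (u : R) • ![a, b] ↔ _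
  rw [funext_iff, Fin.forall_fin_two]
  simp

theorem P1.exists_eq_mk (p : P1 R) : ∃ a b h, p = P1.mk a b h := by
  induction p using Quotient.inductionOn with
  | h v =>
    refine ⟨v.1 0, v.1 1, v.2, congrArg _ (Subtype.ext ?_)⟩
    exact List.ofFn_inj.mp rfl

theorem isCoprime_row_mul {a b : R} (h : IsCoprime a b) (A : SL(2, R)) :
    IsCoprime (a * A.1 0 0 + b * A.1 1 0) (a * A.1 0 1 + b * A.1 1 1) := by
  simpa [Matrix.vecMul, dotProduct, Fin.sum_univ_two] using
    IsCoprime.vecMulSL (v := ![a, b]) (by simpa using h) A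

theorem slMap_mk {a b : R} (h : IsCoprime a b) (A : SL(2, R)) :
    slMap A (P1.mk a b h) =
      P1.mk (a * A.1 0 0 + b * A.1 1 0) (a * A.1 0 1 + b * A.1 1 1) (isCoprime_row_mul h A) := by
  refine Quotient.sound ⟨1, ?_⟩
  ext j
  fin_cases j <;> simp [Matrix.vecMul, dotProduct, Fin.sum_univ_two]

variable (R) in
/-- The point `∞ = [0, 1]` of the projective line. -/
abbrev P1.infinity : P1 R := P1.mk 0 1 isCoprime_one_right

theorem exists_slMap_infinity_eq (p : P1 R) :
    ∃ A : SL(2, R), slMap A (P1.infinity R) = p := by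
  obtain ⟨a, b, ⟨u, v, huv⟩, rfl⟩ := p.exists_eq_mk
  obtain ⟨A, hA⟩ : ∃ A : SL(2, R), A.1 = !![v, -u; a, b] :=
    ⟨⟨_, by rw [Matrix.det_fin_two_of]; linear_combination huv⟩, rfl⟩
  refine ⟨A, ?_⟩
  rw [slMap_mk]
  exact (P1.mk_eq_mk_iff _ _).2 ⟨1, by simp [hA], by simp [hA]⟩

/-- The point `[1, r]` of the projective line. -/
def P1.affine (r : R) : P1 R := P1.mk 1 r isCoprime_one_left

/-- The point `[m, -1]` of the projective line, the image of `[1, m]` under `τ`. For `m` in the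
maximal ideal of a local ring, these are the points equivalent to `∞`. -/
def P1.coaffine (m : R) : P1 R := P1.mk m (-1) isCoprime_one_right.neg_right

theorem P1.affine_injective : Function.Injective (P1.affine (R := R)) := by
  intro r s h
  obtain ⟨u, h1, h2⟩ := (P1.mk_eq_mk_iff _ _).1 h
  rw [h2, ← mul_one (u : R), ← h1, one_mul]

theorem P1.coaffine_injective : Function.Injective (P1.coaffine (R := R)) := by
  intro m n h
  obtain ⟨u, h1, h2⟩ := (P1.mk_eq_mk_iff _ _).1 h
  linear_combination -h1 - m * h2

theorem P1.coaffine_zero : P1.coaffine (0 : R) = P1.infinity R :=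
  (P1.mk_eq_mk_iff _ _).2 ⟨-1, by simp, by simp⟩

theorem slMap_upperMatrix_affine (r s : R) :
    slMap (upperMatrix r) (P1.affine s) = P1.affine (s + r) := by
  rw [P1.affine, slMap_mk, P1.affine, P1.mk_eq_mk_iff]
  exact ⟨1, by simp [upperMatrix], by simp [upperMatrix, add_comm]⟩

theorem slMap_upperMatrix_coaffine {m n : R} (r : R) (h : IsUnit (1 - m * r))
    (hn : (1 - m * r) * n = m) :
    slMap (upperMatrix r) (P1.coaffine m) = P1.coaffine n := by
  obtain ⟨c, hc⟩ := h
  rw [P1.coaffine, slMap_mk, P1.coaffine, eq_comm, P1.mk_eq_mk_iff]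
  exact ⟨c, by simp [upperMatrix, hc, hn], by
    simp only [upperMatrix, hc]; simp [sub_eq_add_neg]⟩

theorem slMap_tauMatrix_affine (r : R) : slMap (tauMatrix R) (P1.affine r) = P1.coaffine r := by
  rw [P1.affine, slMap_mk, P1.coaffine, P1.mk_eq_mk_iff]
  exact ⟨1, by simp [tauMatrix], by simp [tauMatrix]⟩

theorem slMap_tauMatrix_coaffine (m : R) :
    slMap (tauMatrix R) (P1.coaffine m) = P1.affine m := by
  rw [P1.coaffine, slMap_mk, P1.affine, P1.mk_eq_mk_iff]
  exact ⟨-1, by simp [tauMatrix], by simp [tauMatrix]⟩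

variable [IsLocalRing R]

open IsLocalRing

theorem P1.rel_mk_mk_iff {a b c d : R} (h : IsCoprime a b) (h' : IsCoprime c d) :
    P1.rel R (P1.mk a b h) (P1.mk c d h') ↔ a * d - b * c ∈ maximalIdeal R :=
  Iff.rfl

theorem P1.exists_eq_affine_or_exists_eq_coaffine (p : P1 R) :
    (∃ r, p = P1.affine r) ∨ ∃ m ∈ maximalIdeal R, p = P1.coaffine m := by
  obtain ⟨a, b, h, rfl⟩ := p.exists_eq_mk
  by_cases ha : IsUnit a
  · obtain ⟨u, rfl⟩ := ha
    exact Or.inl ⟨↑u⁻¹ * b, (P1.mk_eq_mk_iff _ _).2 ⟨u⁻¹, by simp, by simp⟩⟩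
  · have hb : IsUnit b := by
      obtain ⟨c, d, hcd⟩ := h
      by_contra hb
      exact (maximalIdeal.isMaximal R).ne_top <| (Ideal.eq_top_iff_one _).2 <|
        hcd ▸ add_mem (Ideal.mul_mem_left _ c ha) (Ideal.mul_mem_left _ d hb)
    obtain ⟨u, rfl⟩ := hb
    exact Or.inr ⟨-(↑u⁻¹ * a), neg_mem (Ideal.mul_mem_left _ _ ha),
      (P1.mk_eq_mk_iff _ _).2 ⟨-u⁻¹, by simp, by simp⟩⟩

theorem P1.rel_coaffine_coaffine {m n : R} (hm : m ∈ maximalIdeal R) (hn : n ∈ maximalIdeal R) :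
    P1.rel R (P1.coaffine m) (P1.coaffine n) := by
  rw [P1.coaffine, P1.coaffine, P1.rel_mk_mk_iff]
  simpa [neg_add_eq_sub] using sub_mem hn hm

theorem P1.not_rel_affine_coaffine (r : R) {m : R} (hm : m ∈ maximalIdeal R) :
    ¬ P1.rel R (P1.affine r) (P1.coaffine m) := by
  rw [P1.affine, P1.coaffine, P1.rel_mk_mk_iff]
  intro h
  refine (maximalIdeal.isMaximal R).ne_top ((Ideal.eq_top_iff_one _).2 ?_)
  simpa using neg_mem (add_mem h (Ideal.mul_mem_left _ r hm))

theorem P1.not_rel_affine_infinity (r : R) :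
    ¬ P1.rel R (P1.affine r) (P1.infinity R) :=
  P1.coaffine_zero (R := R) ▸ P1.not_rel_affine_coaffine r (zero_mem _)

theorem P1.exists_eq_affine_of_not_rel {p : P1 R}
    (hp : ¬ P1.rel R p (P1.infinity R)) : ∃ r, p = P1.affine r := by
  obtain hr | ⟨m, hm, rfl⟩ := p.exists_eq_affine_or_exists_eq_coaffine
  · exact hr
  · rw [← P1.coaffine_zero] at hp
    exact absurd (P1.rel_coaffine_coaffine hm (zero_mem _)) hp

theorem P1.exists_eq_coaffine_of_rel {p : P1 R}
    (hp : P1.rel R p (P1.infinity R)) :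
    ∃ m ∈ maximalIdeal R, p = P1.coaffine m := by
  obtain ⟨r, rfl⟩ | hm := p.exists_eq_affine_or_exists_eq_coaffine
  · exact absurd hp (P1.not_rel_affine_infinity r)
  · exact hm

end ProjectiveLine

section ProjectiveMoufangSet

open IsLocalRing

variable {R : Type u} [CommRing R] [IsLocalRing R]

theorem unop_slHom_smul (A : SL(2, R)) (p : P1 R) : (slHom A).unop • p = slMap A p := rfl

theorem unop_slHom_mul (A B : SL(2, R)) :
    (slHom (A * B)).unop = (slHom B).unop * (slHom A).unop := by
  rw [map_mul, MulOpposite.unop_mul]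

theorem unop_slHom_inv (A : SL(2, R)) : (slHom A⁻¹).unop = (slHom A).unop⁻¹ := by
  rw [map_inv, MulOpposite.unop_inv]

theorem induced_slHom_eq {A B : SL(2, R)}
    (h : ∀ j k, A.1 j k - B.1 j k ∈ maximalIdeal R) :
    induced (P1.rel R) (slHom A).unop = induced (P1.rel R) (slHom B).unop := by
  ext q
  induction q using Quotient.inductionOn with
  | h p =>
    refine Quotient.sound (?_ : P1.rel R (slMap A p) (slMap B p))
    obtain ⟨a, b, hab, rfl⟩ := p.exists_eq_mk
    rw [slMap_mk, slMap_mk, P1.rel_mk_mk_iff]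
    have hcol (k : Fin 2) :
        a * (A.1 0 k - B.1 0 k) + b * (A.1 1 k - B.1 1 k) ∈ maximalIdeal R :=
      add_mem (Ideal.mul_mem_left _ a (h 0 k)) (Ideal.mul_mem_left _ b (h 1 k))
    convert sub_mem (Ideal.mul_mem_right (a * B.1 0 1 + b * B.1 1 1) _ (hcol 0))
      (Ideal.mul_mem_right (a * B.1 0 0 + b * B.1 1 0) _ (hcol 1)) using 1
    ring

variable (R) in
/-- The permutations `[a, b] ↦ [a, a r + b]` of the projective line, the root group of `∞`. -/
def translations : Subgroup (SymRel (P1.rel R)) := ((upper R).map pslHom).unop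

theorem mem_translations_iff {g : SymRel (P1.rel R)} :
    g ∈ translations R ↔ ∃ r, g = (slHom (upperMatrix r)).unop := by
  constructor
  · rintro ⟨_, ⟨r, rfl⟩, hr⟩
    exact ⟨r, congrArg MulOpposite.unop hr.symm⟩
  · rintro ⟨r, rfl⟩
    exact ⟨_, ⟨r, rfl⟩, rfl⟩

theorem sharplyTransitiveOn_translations :
    SharplyTransitiveOn (translations R)
      {p | ¬ P1.rel R p (P1.infinity R)} := by
  intro p hp q hq
  obtain ⟨a, rfl⟩ := P1.exists_eq_affine_of_not_rel hp
  obtain ⟨b, rfl⟩ := P1.exists_eq_affine_of_not_rel hq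
  refine ⟨_, ⟨mem_translations_iff.2 ⟨b - a, rfl⟩, ?_⟩, ?_⟩
  · rw [unop_slHom_smul, slMap_upperMatrix_affine, add_sub_cancel]
  · rintro g ⟨hg, hga⟩
    obtain ⟨r, rfl⟩ := mem_translations_iff.1 hg
    rw [unop_slHom_smul, slMap_upperMatrix_affine] at hga
    rw [← P1.affine_injective hga, add_sub_cancel_left]

theorem smul_infinity_of_mem_translations {g : SymRel (P1.rel R)} (hg : g ∈ translations R) :
    g • P1.infinity R = P1.infinity R := by
  obtain ⟨r, rfl⟩ := mem_translations_iff.1 hg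
  rw [← P1.coaffine_zero]
  exact slMap_upperMatrix_coaffine r (by simp) (by simp)

theorem sharplyTransitiveOn_map_induced_translations :
    SharplyTransitiveOn ((translations R).map (induced (P1.rel R)))
      {q | q ≠ Quotient.mk (P1.rel R) (P1.infinity R)} := by
  intro p hp q hq
  induction p, q using Quotient.inductionOn₂ with
  | h p q =>
    obtain ⟨a, rfl⟩ := P1.exists_eq_affine_of_not_rel fun h => hp (Quotient.sound h)
    obtain ⟨b, rfl⟩ := P1.exists_eq_affine_of_not_rel fun h => hq (Quotient.sound h)
    refine ⟨_, ⟨⟨_, mem_translations_iff.2 ⟨b - a, rfl⟩, rfl⟩, ?_⟩, ?_⟩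
    · refine congrArg (Quotient.mk (P1.rel R))
        ((slMap_upperMatrix_affine (b - a) a).trans (by rw [add_sub_cancel]))
    · rintro _ ⟨⟨g, hg, rfl⟩, hga⟩
      obtain ⟨r, rfl⟩ := mem_translations_iff.1 hg
      have hrel : P1.rel R (slMap (upperMatrix r) (P1.affine a)) (P1.affine b) :=
        Quotient.exact hga
      rw [slMap_upperMatrix_affine, P1.affine, P1.affine, P1.rel_affine] at hrel
      have hdiff : r - (b - a) ∈ maximalIdeal R := by
        rwa [sub_sub_eq_add_sub, add_comm r]
      refine induced_slHom_eq fun j k => ?_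
      fin_cases j <;> fin_cases k <;> simp [upperMatrix, hdiff, -mem_maximalIdeal]

theorem conjBy_translations_le {A : SL(2, R)}
    (hA : slMap A (P1.infinity R) = P1.infinity R) :
    conjBy (translations R) (slHom A).unop ≤ translations R := by
  rintro _ ⟨g, hg, rfl⟩
  obtain ⟨r, rfl⟩ := mem_translations_iff.1 hg
  have hA' : A.1 1 0 = 0 := by
    rw [slMap_mk, P1.mk_eq_mk_iff] at hA
    obtain ⟨u, hu, -⟩ := hA
    simpa using hu.symm
  have hdet : A.1 0 0 * A.1 1 1 = 1 := by
    have := A.2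
    rwa [Matrix.det_fin_two, hA', mul_zero, sub_zero] at this
  have hmul : upperMatrix r * A = A * upperMatrix (r * A.1 1 1 ^ 2) := by
    ext j k
    rw [Matrix.SpecialLinearGroup.coe_mul, Matrix.SpecialLinearGroup.coe_mul]
    fin_cases j <;> fin_cases k <;>
      simp [upperMatrix, Matrix.mul_apply, Fin.sum_univ_two, hA']
    linear_combination (-(r * A.1 1 1)) * hdet
  refine mem_translations_iff.2 ⟨r * A.1 1 1 ^ 2, ?_⟩
  rw [← inv_mul_cancel_left A (upperMatrix (r * A.1 1 1 ^ 2)), ← hmul, unop_slHom_mul,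
    unop_slHom_mul, unop_slHom_inv]
  rfl

theorem conjBy_translations_eq {A : SL(2, R)}
    (hA : slMap A (P1.infinity R) = P1.infinity R) :
    conjBy (translations R) (slHom A).unop = translations R := by
  refine le_antisymm (conjBy_translations_le hA) fun g hg => ?_
  have hA' : slMap A⁻¹ (P1.infinity R) = P1.infinity R := by
    rw [← hA, ← slMap_mul, mul_inv_cancel, slMap_one, hA]
  rw [mem_conjBy_iff]
  refine conjBy_translations_le hA' (mem_conjBy_iff.2 ?_)
  simpa [unop_slHom_inv, mul_assoc] using hg

theorem exists_alphaOf_translations_eq {p q : P1 R} (hp : ¬ P1.rel R p (P1.infinity R))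
    (hq : ¬ P1.rel R q (P1.infinity R)) :
    ∃ r, alphaOf (translations R) p q = (slHom (upperMatrix r)).unop ∧
      slMap (upperMatrix r) p = q := by
  obtain ⟨hmem, hsmul⟩ :=
    alphaOf_mem_and_smul (sharplyTransitiveOn_translations p hp q hq).exists
  obtain ⟨r, hr⟩ := mem_translations_iff.1 hmem
  exact ⟨r, hr, by rwa [hr] at hsmul⟩

theorem construct_U_of_rel {X : Type u} {r : Setoid X} {U : Subgroup (SymRel r)} {τ : SymRel r}
    {i x : X} (h : r x i) : (construct r U τ i).U x =
      conjBy U (τ * alphaOf U (τ • i) (τ⁻¹ • x) * τ⁻¹) :=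
  if_pos h

theorem construct_U_of_not_rel {X : Type u} {r : Setoid X} {U : Subgroup (SymRel r)}
    {τ : SymRel r} {i x : X} (h : ¬ r x i) : (construct r U τ i).U x =
      conjBy (conjBy U τ) (alphaOf U (τ • i) x) :=
  if_neg h

theorem exists_projective_U_eq_conjBy (p : P1 R) :
    ∃ A : SL(2, R), slMap A (P1.infinity R) = p ∧
      (projective R).U p = conjBy (translations R) (slHom A).unop := by
  have hτ : (slHom (tauMatrix R)).unop • P1.infinity R = P1.affine 0 := by
    rw [unop_slHom_smul, ← P1.coaffine_zero, slMap_tauMatrix_coaffine]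
  have hU : (projective R).U = (construct (P1.rel R) (translations R)
      (slHom (tauMatrix R)).unop (P1.infinity R)).U := rfl
  rw [hU]
  by_cases hp : P1.rel R p (P1.infinity R)
  · rw [construct_U_of_rel hp, hτ]
    obtain ⟨m, -, rfl⟩ := P1.exists_eq_coaffine_of_rel hp
    have hτm (m : R) : (slHom (tauMatrix R)).unop⁻¹ • P1.coaffine m = P1.affine m := by
      rw [inv_smul_eq_iff, unop_slHom_smul, slMap_tauMatrix_affine]
    obtain ⟨r, hr, hrm⟩ := exists_alphaOf_translations_eq
      (P1.not_rel_affine_infinity (0 : R)) (P1.not_rel_affine_infinity m)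
    refine ⟨(tauMatrix R)⁻¹ * (upperMatrix r * tauMatrix R), ?_, ?_⟩
    · rw [slMap_mul, slMap_mul, ← unop_slHom_smul (tauMatrix R)⁻¹, unop_slHom_inv,
        ← P1.coaffine_zero, hτm, hrm, slMap_tauMatrix_affine]
    · rw [hτm, hr, unop_slHom_mul, unop_slHom_mul, unop_slHom_inv]
  · rw [construct_U_of_not_rel hp, hτ]
    obtain ⟨r, hr, hrp⟩ := exists_alphaOf_translations_eq
      (P1.not_rel_affine_infinity (0 : R)) hp
    refine ⟨tauMatrix R * upperMatrix r, ?_, ?_⟩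
    · rw [slMap_mul, ← unop_slHom_smul (tauMatrix R), hτ, hrp]
    · rw [hr, conjBy_conjBy, unop_slHom_mul]

theorem conjBy_translations_eq_of_slMap_infinity_eq {A B : SL(2, R)}
    (h : slMap A (P1.infinity R) = slMap B (P1.infinity R)) :
    conjBy (translations R) (slHom A).unop = conjBy (translations R) (slHom B).unop := by
  have hAB : slMap (A * B⁻¹) (P1.infinity R) = P1.infinity R := by
    rw [slMap_mul, h, ← slMap_mul, mul_inv_cancel, slMap_one]
  calc conjBy (translations R) (slHom A).unop
      = conjBy (conjBy (translations R) (slHom (A * B⁻¹)).unop) (slHom B).unop := by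
        rw [conjBy_conjBy, ← unop_slHom_mul, inv_mul_cancel_right]
    _ = conjBy (translations R) (slHom B).unop := by rw [conjBy_translations_eq hAB]

theorem projective_U_slMap_infinity (A : SL(2, R)) :
    (projective R).U (slMap A (P1.infinity R)) =
      conjBy (translations R) (slHom A).unop := by
  obtain ⟨B, hB, hU⟩ := exists_projective_U_eq_conjBy (slMap A (P1.infinity R))
  exact hU.trans (conjBy_translations_eq_of_slMap_infinity_eq hB)

theorem projective_U_infinity :
    (projective R).U (P1.infinity R) = translations R := by
  rw [← slMap_one (P1.infinity R), projective_U_slMap_infinity,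
    conjBy_translations_eq (slMap_one _)]

theorem conjBy_projective_U (A : SL(2, R)) (p : P1 R) :
    conjBy ((projective R).U p) (slHom A).unop = (projective R).U ((slHom A).unop • p) := by
  obtain ⟨B, rfl⟩ := exists_slMap_infinity_eq p
  rw [unop_slHom_smul, ← slMap_mul, projective_U_slMap_infinity, projective_U_slMap_infinity,
    unop_slHom_mul]
  exact conjBy_conjBy _ _ _

theorem projective_Ubar_eq_of_rel {p : P1 R} (hp : P1.rel R p (P1.infinity R)) :
    (projective R).Ubar p = (projective R).Ubar (P1.infinity R) := by
  obtain ⟨m, hm, rfl⟩ := P1.exists_eq_coaffine_of_rel hp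
  obtain ⟨A, hA⟩ : ∃ A : SL(2, R), A.1 = !![1, 0; -m, 1] := ⟨⟨_, by simp⟩, rfl⟩
  have hAm : slMap A (P1.infinity R) = P1.coaffine m := by
    rw [slMap_mk, P1.coaffine]
    exact (P1.mk_eq_mk_iff _ _).2 ⟨-1, by simp [hA], by simp [hA]⟩
  have hA1 : induced (P1.rel R) (slHom A).unop = 1 := by
    rw [induced_slHom_eq (B := 1), map_one, MulOpposite.unop_one, map_one]
    intro j k
    rw [hA]
    fin_cases j <;> fin_cases k <;> simp [-mem_maximalIdeal, hm]
  rw [Data.Ubar, Data.Ubar, ← hAm, projective_U_slMap_infinity, projective_U_infinity]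
  exact (map_conjBy (induced (P1.rel R)) _ _).trans
    (hA1 ▸ conjBy_eq_self_of_mem (one_mem _))

theorem two_lt_mk_of_ne {α : Type u} {a b c : α} (hab : a ≠ b) (hac : a ≠ c) (hbc : b ≠ c) :
    2 < Cardinal.mk α := by
  classical
  calc (2 : Cardinal) < (3 : ℕ) := by norm_num
    _ = Cardinal.mk ({a, b, c} : Finset α) := by
      rw [Cardinal.mk_coe_finset, Finset.card_eq_three.2 ⟨a, b, c, hab, hac, hbc, rfl⟩]
    _ ≤ Cardinal.mk α := Cardinal.mk_set_le _

theorem two_lt_mk_quotient_rel : 2 < Cardinal.mk (Quotient (P1.rel R)) := by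
  refine two_lt_mk_of_ne (a := Quotient.mk _ (P1.infinity R)) (b := Quotient.mk _ (P1.affine 0))
    (c := Quotient.mk _ (P1.affine 1)) ?_ ?_ ?_
  · exact fun h => P1.not_rel_affine_infinity 0 (Quotient.exact h.symm)
  · exact fun h => P1.not_rel_affine_infinity 1 (Quotient.exact h.symm)
  · intro h
    have h01 : (0 : R) - 1 ∈ maximalIdeal R := (P1.rel_affine 0 1).1 (Quotient.exact h)
    simp at h01

variable (R) in
theorem projective_isLocalMoufangSet : (projective R).IsLocalMoufangSet := by
  refine Data.isLocalMoufangSet_of_transitive (H := (slHom (R := R)).range.unop)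
    (i := P1.infinity R) two_lt_mk_quotient_rel (fun p => ?_) ?_ ?_ ?_ ?_ ?_
    fun p => projective_Ubar_eq_of_rel
  · obtain ⟨A, rfl⟩ := exists_slMap_infinity_eq p
    exact ⟨_, ⟨A, rfl⟩, rfl⟩
  · rintro g ⟨A, hA⟩ p
    obtain rfl : (slHom A).unop = g := congrArg MulOpposite.unop hA
    exact conjBy_projective_U A p
  · rw [projective_U_infinity]
    intro g hg
    obtain ⟨r, rfl⟩ := mem_translations_iff.1 hg
    exact ⟨upperMatrix r, rfl⟩
  · rw [projective_U_infinity]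
    exact fun g => smul_infinity_of_mem_translations
  · rw [projective_U_infinity]
    exact sharplyTransitiveOn_translations
  · rw [Data.Ubar, projective_U_infinity]
    exact sharplyTransitiveOn_map_induced_translations

end ProjectiveMoufangSet

/-- A commutative ring structure on an additive group, from a commuting family of endomorphisms
`L x` that map `e` to `x`: the product `x * y` is `L y x` and the identity is `e`. -/
abbrev commRingOfCommute {A : Type*} [AddCommGroup A] (L : A → AddMonoid.End A) (e : A)
    (hL : ∀ x y, Commute (L x) (L y)) (he : ∀ x, L x e = x) : CommRing A :=
  have comm_apply (x y z : A) : L x (L y z) = L y (L x z) := DFunLike.congr_fun (hL x y) z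
  have apply_comm (x y : A) : L y x = L x y := by
    rw [← he x, comm_apply, he, he]
  { ‹AddCommGroup A› with
    mul := fun x y => L y x
    one := e
    mul_comm := fun x y => apply_comm x y
    mul_assoc := fun x y z => by
      change L z (L y x) = L (L z y) x
      rw [apply_comm x (L z y), apply_comm x y, comm_apply]
    one_mul := he
    mul_one := fun x => (apply_comm x e).trans (he x)
    right_distrib := fun x y z => map_add (L z) x y
    left_distrib := fun x y z => by
      change L (y + z) x = L y x + L z x
      rw [apply_comm, map_add, apply_comm x y, apply_comm x z]
    zero_mul := fun x => map_zero (L x)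
    mul_zero := fun x => (apply_comm x 0).trans (map_zero (L x)) }

/-- A local Moufang set with a basis, that is, with inequivalent points `o` and `i` that play
the roles of `0` and `∞`. -/
structure Based (X : Type u) where
  M : Data X
  isLocalMoufangSet : M.IsLocalMoufangSet
  o : X
  i : X
  not_rel : ¬ M.rel o i

namespace Based

variable {X : Type u} {F : Based X}

/-- The group `Sym(X, ∼)`. -/
abbrev Sym (F : Based X) : Type u := SymRel F.M.rel

/-- The points that are not equivalent to `∞`, a group under `x + y = 0 α_x α_y`. -/
def R (F : Based X) : Type u := F.M.RingCarrier F.i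

/-- The underlying point of `X`. -/
def R.pt (x : F.R) : X := Subtype.val x

theorem R.not_rel (x : F.R) : ¬ F.M.rel x.pt F.i := Subtype.property x

/-- A point that is not equivalent to `∞`, as an element of `R`. -/
def R.mk (p : X) (h : ¬ F.M.rel p F.i) : F.R := ⟨p, h⟩

theorem R.pt_mk {p : X} (h : ¬ F.M.rel p F.i) : (R.mk p h).pt = p := rfl

theorem R.ext {x y : F.R} (h : x.pt = y.pt) : x = y := Subtype.ext h

theorem not_rel' (F : Based X) : ¬ F.M.rel F.i F.o := fun h => F.not_rel (F.M.rel.symm' h)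

section RootGroup

/-- The element `α_x` of `U_∞`. -/
def α (x : F.R) : F.Sym := F.M.alpha F.o F.i x.pt

theorem α_mem (x : F.R) : α x ∈ F.M.U F.i :=
  F.isLocalMoufangSet.alphaOf_mem F.not_rel x.not_rel

theorem α_smul_o (x : F.R) : α x • F.o = x.pt :=
  F.isLocalMoufangSet.alphaOf_smul F.not_rel x.not_rel

theorem eq_α {x : F.R} {g : F.Sym} (hg : g ∈ F.M.U F.i) (h : g • F.o = x.pt) : g = α x :=
  F.isLocalMoufangSet.root_ext hg (α_mem x) F.not_rel (h.trans (α_smul_o x).symm)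

theorem α_injective : Function.Injective (α : F.R → F.Sym) := fun x y h =>
  R.ext (by rw [← α_smul_o x, h, α_smul_o])

/-- The bijection `x ↦ α_x` between `R` and `U_∞`. The opposite group accounts for the
composition of permutations from left to right in `x + y = 0 α_x α_y`. -/
def rootEquiv (F : Based X) : F.R ≃ Additive (F.M.U F.i)ᵐᵒᵖ where
  toFun x := Additive.ofMul (MulOpposite.op ⟨α x, α_mem x⟩)
  invFun g := ⟨g.toMul.unop.1 • F.o,
    (F.isLocalMoufangSet.rel_smul_iff_of_mem g.toMul.unop.2 F.o).not.2 F.not_rel⟩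
  left_inv x := R.ext (α_smul_o x)
  right_inv g := Additive.toMul.injective
    (MulOpposite.unop_injective (Subtype.ext (eq_α g.toMul.unop.2 rfl).symm))

instance : AddGroup F.R := F.rootEquiv.addGroup

theorem α_add (x y : F.R) : α (x + y) = α y * α x :=
  (eq_α (mul_mem (α_mem y) (α_mem x)) rfl).symm

theorem α_zero : α (0 : F.R) = 1 := (eq_α (one_mem _) rfl).symm

theorem α_neg (x : F.R) : α (-x) = (α x)⁻¹ := (eq_α (inv_mem (α_mem x)) rfl).symm

theorem α_nsmul (n : ℕ) (x : F.R) : α (n • x) = α x ^ n := by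
  induction n with
  | zero => rw [zero_nsmul, α_zero, pow_zero]
  | succ n ih => rw [succ_nsmul', α_add, ih, pow_succ]

theorem pt_zero : (0 : F.R).pt = F.o := by rw [← α_smul_o, α_zero, one_smul]

theorem pt_add (x y : F.R) : (x + y).pt = α y • x.pt := by
  rw [← α_smul_o, α_add, mul_smul, α_smul_o]

theorem pt_neg (x : F.R) : (-x).pt = (α x)⁻¹ • F.o := by rw [← α_smul_o, α_neg]

theorem pt_add_eq (x y : F.R) : (x + y).pt = F.M.add F.o F.i x.pt y.pt := by
  rw [← α_smul_o, α_add]; rfl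

theorem pt_neg_eq (x : F.R) : (-x).pt = F.M.neg F.o F.i x.pt := pt_neg x

theorem pt_sub_eq (x y : F.R) : (x - y).pt = F.M.sub F.o F.i x.pt y.pt := by
  rw [sub_eq_add_neg, pt_add_eq, pt_neg_eq]; rfl

theorem pt_nsmul_eq (n : ℕ) (x : F.R) : (n • x).pt = F.M.times F.o F.i x.pt n := by
  rw [← α_smul_o, α_nsmul]; rfl

end RootGroup

section UnitPoints

/-- The equivalence class of `0`. -/
def zeroClass (F : Based X) : AddSubgroup F.R where
  carrier := {x | F.M.rel x.pt F.o}
  zero_mem' := by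
    rw [Set.mem_ofPred_eq, pt_zero]
  add_mem' := by
    intro x y hx hy
    rw [Set.mem_ofPred_eq, pt_add]
    refine F.M.rel.trans' ((rel_smul_smul_iff (α y) _ _).2 hx) ?_
    rwa [α_smul_o]
  neg_mem' := by
    intro x hx
    rw [Set.mem_ofPred_eq, pt_neg, ← rel_smul_smul_iff (α x), smul_inv_smul, α_smul_o]
    exact F.M.rel.symm' hx

/-- The units in the sense of local Moufang sets: the elements of `R` outside the class of `0`. -/
def R.IsUnitPt (x : F.R) : Prop := ¬ F.M.rel x.pt F.o

theorem not_isUnitPt_iff {x : F.R} : ¬ x.IsUnitPt ↔ x ∈ zeroClass F := not_not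

theorem isUnitPt_pt_iff {x : F.R} : F.M.IsUnitPt F.o F.i x.pt ↔ x.IsUnitPt :=
  ⟨fun h => h.1, fun h => ⟨h, x.not_rel⟩⟩

theorem rel_pt_iff {x y : F.R} : F.M.rel x.pt y.pt ↔ x - y ∈ zeroClass F := by
  rw [← sub_add_cancel x y, pt_add, ← α_smul_o y, rel_smul_smul_iff, add_sub_cancel_right]
  rfl

theorem R.IsUnitPt.neg {x : F.R} (hx : x.IsUnitPt) : (-x).IsUnitPt :=
  (neg_mem_iff (S := AddSubgroup F.R) (H := zeroClass F)).not.2 hx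

theorem R.IsUnitPt.add_zeroClass {x y : F.R} (hx : x.IsUnitPt) (hy : y ∈ zeroClass F) :
    (x + y).IsUnitPt :=
  ((zeroClass F).add_mem_cancel_right hy).not.2 hx

theorem R.IsUnitPt.zeroClass_add {x y : F.R} (hx : x.IsUnitPt) (hy : y ∈ zeroClass F) :
    (y + x).IsUnitPt :=
  ((zeroClass F).add_mem_cancel_left hy).not.2 hx

theorem exists_isUnitPt (F : Based X) : ∃ x : F.R, x.IsUnitPt := by
  have hcard : 3 ≤ Cardinal.mk (Quotient F.M.rel) := by
    have h := Cardinal.natCast_add_one_le_iff.2 F.isLocalMoufangSet.two_lt_card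
    rwa [Nat.cast_two, two_add_one_eq_three] at h
  obtain ⟨q, hqo, hqi⟩ := Cardinal.exists_ne_ne_of_three_le hcard
    (Quotient.mk F.M.rel F.o) (Quotient.mk F.M.rel F.i)
  induction q using Quotient.inductionOn with
  | h p => exact ⟨R.mk p fun h => hqi (Quotient.sound h), fun h => hqo (Quotient.sound h)⟩

theorem closure_isUnitPt_eq_top (F : Based X) :
    AddSubgroup.closure {x : F.R | x.IsUnitPt} = ⊤ := by
  refine eq_top_iff.2 fun x _ => ?_
  obtain ⟨u, hu⟩ := F.exists_isUnitPt
  by_cases hx : x.IsUnitPt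
  · exact AddSubgroup.subset_closure hx
  · rw [← add_sub_cancel_right x u]
    exact sub_mem (AddSubgroup.subset_closure (hu.zeroClass_add (not_isUnitPt_iff.1 hx)))
      (AddSubgroup.subset_closure hu)

end UnitPoints

section Swaps

/-- The points not equivalent to `∞` as elements of `R`, with the junk value `0` at all others. -/
def toR (F : Based X) (p : X) : F.R :=
  open Classical in if h : F.M.rel p F.i then 0 else R.mk p h

theorem pt_toR {p : X} (h : ¬ F.M.rel p F.i) : (toR F p).pt = p := by
  rw [toR, dif_neg h, R.pt_mk]

theorem toR_pt (x : F.R) : toR F x.pt = x := R.ext (pt_toR x.not_rel)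

/-- The image of a point of `R` under a permutation, as an element of `R`; it has the junk value
`0` if the image is equivalent to `∞`. -/
def act (g : F.Sym) (x : F.R) : F.R := toR F (g • x.pt)

/-- Elements of the little projective group that interchange `0` and `∞`. -/
structure IsSwap (m : F.Sym) : Prop where
  mem : m ∈ F.M.G
  smul_o : m • F.o = F.i
  smul_i : m • F.i = F.o

namespace IsSwap

variable {m : F.Sym}

theorem inv (h : IsSwap m) : IsSwap m⁻¹ :=
  ⟨inv_mem h.mem, by rw [← h.smul_i, inv_smul_smul], by rw [← h.smul_o, inv_smul_smul]⟩

theorem rel_i (h : IsSwap m) (p : X) : F.M.rel (m • p) F.i ↔ F.M.rel p F.o :=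
  rel_smul_iff_of_smul_eq h.smul_o p

theorem rel_o (h : IsSwap m) (p : X) : F.M.rel (m • p) F.o ↔ F.M.rel p F.i :=
  rel_smul_iff_of_smul_eq h.smul_i p

theorem pt_act (h : IsSwap m) {x : F.R} (hx : x.IsUnitPt) : (act m x).pt = m • x.pt :=
  pt_toR ((h.rel_i _).not.2 hx)

theorem isUnitPt_act (h : IsSwap m) {x : F.R} (hx : x.IsUnitPt) : (act m x).IsUnitPt := by
  rw [R.IsUnitPt, h.pt_act hx, h.rel_o]
  exact x.not_rel

end IsSwap

/-- The element of `U_0` that maps `∞` to `p`, for a unit `p`. -/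
def β (p : F.R) : F.Sym := alphaOf (F.M.U F.o) F.i p.pt

theorem β_mem {p : F.R} (hp : p.IsUnitPt) : β p ∈ F.M.U F.o :=
  F.isLocalMoufangSet.alphaOf_mem F.not_rel' hp

theorem β_smul_i {p : F.R} (hp : p.IsUnitPt) : β p • F.i = p.pt :=
  F.isLocalMoufangSet.alphaOf_smul F.not_rel' hp

theorem eq_β {p : F.R} {g : F.Sym} (hg : g ∈ F.M.U F.o) (h : g • F.i = p.pt) : g = β p := by
  have hp : p.IsUnitPt := by
    rw [R.IsUnitPt, ← h]
    exact (F.isLocalMoufangSet.rel_smul_iff_of_mem hg _).not.2 F.not_rel'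
  exact F.isLocalMoufangSet.root_ext hg (β_mem hp) F.not_rel' (h.trans (β_smul_i hp).symm)

theorem IsSwap.conj_α {m : F.Sym} (h : IsSwap m) {x : F.R} (hx : x.IsUnitPt) :
    m * α x * m⁻¹ = β (act m x) := by
  refine eq_β ?_ ?_
  · rw [← h.smul_i]
    exact F.isLocalMoufangSet.conj_mem h.mem (α_mem x)
  · rw [mul_smul, h.inv.smul_i, mul_smul, α_smul_o, h.pt_act hx]

theorem IsSwap.conj_β {m : F.Sym} (h : IsSwap m) {x : F.R} (hx : x.IsUnitPt) :
    m * β x * m⁻¹ = α (act m x) := by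
  refine eq_α ?_ ?_
  · rw [← h.smul_o]
    exact F.isLocalMoufangSet.conj_mem h.mem (β_mem hx)
  · rw [mul_smul, h.inv.smul_o, mul_smul, β_smul_i hx, h.pt_act hx]

theorem isSwap_of_isMu {x : F.R} {m : F.Sym} (h : F.M.IsMu F.o F.i x.pt m) : IsSwap m := by
  obtain ⟨⟨g, hg, k, hk, rfl⟩, ho, hi⟩ := h
  exact ⟨mul_mem (mul_mem (F.M.root_le_G _ hk) (F.M.root_le_G _ (α_mem x)))
    (F.M.root_le_G _ hg), ho, hi⟩

theorem isMu_β_inv_mul_α_mul_β_neg {x : F.R} (hx : x.IsUnitPt) :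
    F.M.IsMu F.o F.i x.pt ((β x)⁻¹ * α x * β (-x)) := by
  refine ⟨⟨β (-x), β_mem hx.neg, (β x)⁻¹, inv_mem (β_mem hx), rfl⟩, ?_, ?_⟩
  · rw [mul_smul, F.isLocalMoufangSet.LM1_fix _ _ (β_mem hx.neg), mul_smul, α_smul_o,
      inv_smul_eq_iff, β_smul_i hx]
  · rw [mul_smul, β_smul_i hx.neg, mul_smul, ← pt_add, neg_add_cancel, pt_zero]
    exact F.isLocalMoufangSet.LM1_fix _ _ (inv_mem (β_mem hx))

/-- The map `μ_x`. -/
def μ (x : F.R) : F.Sym := F.M.mu F.o F.i x.pt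

theorem isMu_μ {x : F.R} (hx : x.IsUnitPt) : F.M.IsMu F.o F.i x.pt (μ x) := by
  have h : ∃ m, F.M.IsMu F.o F.i x.pt m := ⟨_, isMu_β_inv_mul_α_mul_β_neg hx⟩
  rw [μ, Data.mu, dif_pos h]
  exact h.choose_spec

theorem isSwap_μ {x : F.R} (hx : x.IsUnitPt) : IsSwap (μ x) := isSwap_of_isMu (isMu_μ hx)

theorem μ_eq_β_inv_mul_α_mul_β_neg {x : F.R} (hx : x.IsUnitPt) :
    μ x = (β x)⁻¹ * α x * β (-x) := by
  obtain ⟨⟨g, hg, k, hk, h⟩, ho, hi⟩ := isMu_μ hx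
  change μ x = k * α x * g at h
  rw [h, mul_smul, mul_smul] at ho hi
  have k_inv_eq : k⁻¹ = β x := by
    refine eq_β (inv_mem hk) ?_
    rw [← ho, inv_smul_smul, F.isLocalMoufangSet.LM1_fix _ _ hg, α_smul_o]
  have g_eq : g = β (-x) := by
    refine eq_β hg ?_
    rw [← eq_inv_smul_iff, F.isLocalMoufangSet.LM1_fix _ _ (inv_mem hk)] at hi
    rw [pt_neg, ← hi, inv_smul_smul]
  rw [h, ← k_inv_eq, ← g_eq, inv_inv]

end Swaps

section Torus

/-- The elements of the little projective group that fix `0` and `∞`. -/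
def torus (F : Based X) : Subgroup F.Sym :=
  F.M.G ⊓ (MulAction.stabilizer F.Sym F.o ⊓ MulAction.stabilizer F.Sym F.i)

theorem IsSwap.mul_mem_torus {m n : F.Sym} (hm : IsSwap m) (hn : IsSwap n) : m * n ∈ torus F :=
  ⟨mul_mem hm.mem hn.mem,
    show (m * n) • F.o = F.o by rw [mul_smul, hn.smul_o, hm.smul_i],
    show (m * n) • F.i = F.i by rw [mul_smul, hn.smul_i, hm.smul_o]⟩

instance : SMul (torus F) F.R where
  smul h x := R.mk (h.1 • x.pt) ((rel_smul_iff_of_smul_eq h.2.2.2 x.pt).not.2 x.not_rel)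

theorem pt_torus_smul (h : torus F) (x : F.R) : (h • x).pt = h.1 • x.pt := rfl

theorem torus_conj_α (h : torus F) (x : F.R) : h.1 * α x * h.1⁻¹ = α (h • x) := by
  refine eq_α ?_ ?_
  · have hi : h.1 • F.i = F.i := h.2.2.2
    rw [← hi]
    exact F.isLocalMoufangSet.conj_mem h.2.1 (α_mem x)
  · rw [mul_smul, inv_smul_eq_iff.2 (Eq.symm h.2.2.1), mul_smul, α_smul_o, pt_torus_smul]

instance : DistribMulAction (torus F) F.R where
  one_smul x := R.ext (one_smul _ x.pt)
  mul_smul g h x := R.ext (mul_smul g.1 h.1 x.pt)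
  smul_zero h := R.ext (by rw [pt_torus_smul, pt_zero]; exact h.2.2.1)
  smul_add h x y := α_injective (by
    simp only [α_add, ← torus_conj_α]
    group)

theorem torus_smul_mem_zeroClass (h : torus F) {x : F.R} (hx : x ∈ zeroClass F) :
    h • x ∈ zeroClass F :=
  (rel_smul_iff_of_smul_eq h.2.2.1 x.pt).2 hx

end Torus

/-- Local Moufang sets that are special: `∼x = -x` for all units `x`, that is, the elements of
`U_0` that map `∞` to `-x` and to `x` are inverse to each other. -/
class IsSpecial (F : Based X) : Prop where
  β_neg : ∀ {x : F.R}, x.IsUnitPt → β (-x) = (β x)⁻¹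

/-- Local Moufang sets in which the double of a unit is a unit. -/
class HasUnitDoubles (F : Based X) : Prop where
  isUnitPt_double : ∀ {x : F.R}, x.IsUnitPt → (2 • x).IsUnitPt

/-- Local Moufang sets with abelian root groups. -/
class IsAbelian (F : Based X) : Prop where
  mul_comm : ∀ a ∈ F.M.U F.i, ∀ b ∈ F.M.U F.i, a * b = b * a

/-- Local Moufang sets with an abelian Hua subgroup. -/
class HasCommHua (F : Based X) : Prop where
  mul_comm : ∀ a ∈ F.M.huaSubgroup F.o F.i, ∀ b ∈ F.M.huaSubgroup F.o F.i, a * b = b * a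

theorem hasUnitDoubles_of_isUnitPt_times_two
    (h : ∀ x, F.M.IsUnitPt F.o F.i x → F.M.IsUnitPt F.o F.i (F.M.times F.o F.i x 2)) :
    F.HasUnitDoubles where
  isUnitPt_double {x} hx := by
    rw [← isUnitPt_pt_iff, pt_nsmul_eq]
    exact h x.pt (isUnitPt_pt_iff.2 hx)

theorem R.IsUnitPt.double [F.HasUnitDoubles] {x : F.R} (hx : x.IsUnitPt) : (2 • x).IsUnitPt :=
  HasUnitDoubles.isUnitPt_double hx

section Special

theorem isSpecial_of_tilde_eq_neg {m : F.Sym} (hm : IsSwap m)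
    (h : ∀ x, F.M.IsUnitPt F.o F.i x → F.M.tilde F.o F.i m x = F.M.neg F.o F.i x) :
    F.IsSpecial where
  β_neg {x} hx := by
    have hmx : (act m⁻¹ x).pt = m⁻¹ • x.pt := hm.inv.pt_act hx
    refine (eq_β (inv_mem (β_mem hx)) ?_).symm
    rw [pt_neg_eq, ← h x.pt (isUnitPt_pt_iff.2 hx), Data.tilde, ← hmx, ← pt_neg_eq, pt_neg,
      ← hm.inv.conj_β hx]
    simp only [mul_inv_rev, inv_inv, mul_smul, hm.smul_o, smul_inv_smul]

variable [F.IsSpecial]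

theorem β_neg {x : F.R} (hx : x.IsUnitPt) : β (-x) = (β x)⁻¹ := IsSpecial.β_neg hx

theorem μ_eq {x : F.R} (hx : x.IsUnitPt) : μ x = (β x)⁻¹ * α x * (β x)⁻¹ := by
  rw [μ_eq_β_inv_mul_α_mul_β_neg hx, β_neg hx]

theorem μ_neg {x : F.R} (hx : x.IsUnitPt) : μ (-x) = (μ x)⁻¹ := by
  rw [μ_eq hx.neg, β_neg hx, μ_eq hx, α_neg]
  group

theorem μ_eq' {x : F.R} (hx : x.IsUnitPt) : μ x = α x * (β x)⁻¹ * α x := by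
  have hm := isSwap_μ hx
  set w := act (μ x)⁻¹ x
  have μ_eq_α_mul : α x * (β x)⁻¹ * (α w)⁻¹ = μ x := by
    have hw : (μ x)⁻¹ * β x * μ x = α w := by simpa only [inv_inv] using hm.inv.conj_β hx
    rw [← hw, mul_inv_rev, mul_inv_rev, inv_inv, ← mul_assoc, ← mul_assoc]
    conv_rhs => rw [μ_eq hx]
    rw [μ_eq hx]
    group
  have α_w_inv : (α w)⁻¹ = α x := by
    refine eq_α (inv_mem (α_mem w)) ?_
    have ho := hm.smul_o
    rwa [← μ_eq_α_mul, mul_smul, mul_smul, ← eq_inv_smul_iff,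
      F.isLocalMoufangSet.LM1_fix _ _ (inv_mem (α_mem x)), inv_smul_eq_iff, β_smul_i hx] at ho
  rw [← μ_eq_α_mul, α_w_inv]

theorem IsSwap.act_neg {m : F.Sym} (h : IsSwap m) {x : F.R} (hx : x.IsUnitPt) :
    act m (-x) = -act m x := by
  apply R.ext
  rw [h.pt_act hx.neg, ← β_smul_i (h.isUnitPt_act hx).neg, β_neg (h.isUnitPt_act hx),
    ← h.conj_α hx, pt_neg]
  simp only [mul_inv_rev, inv_inv, mul_smul, h.inv.smul_i]

theorem μ_smul_neg {x : F.R} (hx : x.IsUnitPt) : μ x • (-x).pt = x.pt := by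
  rw [μ_eq' hx, mul_smul, ← pt_add, neg_add_cancel, pt_zero, mul_smul,
    F.isLocalMoufangSet.LM1_fix _ _ (inv_mem (β_mem hx)), α_smul_o]

theorem act_μ_self {x : F.R} (hx : x.IsUnitPt) : act (μ x) x = -x := by
  rw [← neg_eq_iff_eq_neg, ← (isSwap_μ hx).act_neg hx, act, μ_smul_neg hx, toR_pt]

theorem μ_smul_self {x : F.R} (hx : x.IsUnitPt) : μ x • x.pt = (-x).pt := by
  rw [← (isSwap_μ hx).pt_act hx, act_μ_self hx]

theorem toR_inv_smul_i {z : F.Sym} (hz : z ∈ F.M.U F.o) (hzi : ¬ F.M.rel (z • F.i) F.i) :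
    toR F (z⁻¹ • F.i) = -toR F (z • F.i) := by
  have z_eq : z = β (toR F (z • F.i)) := eq_β hz (pt_toR hzi).symm
  have hU : (toR F (z • F.i)).IsUnitPt := by
    rw [R.IsUnitPt, pt_toR hzi]
    exact (F.isLocalMoufangSet.rel_smul_iff_of_mem hz _).not.2 F.not_rel'
  rw [← toR_pt (-toR F (z • F.i)), ← β_smul_i hU.neg, β_neg hU, ← z_eq]

/-- Both sides are read off from the element `β_b⁻¹ β_{a+b}` of `U_0`: it maps `∞` to
`act μ_b a - b`, and its inverse maps `∞` to `-act μ_{a+b} a - (a + b)`. -/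
theorem act_μ_add {a b : F.R} (ha : a.IsUnitPt) (hb : b.IsUnitPt) (hab : (a + b).IsUnitPt) :
    act (μ (a + b)) a = -b - a + act (μ b) a - b := by
  set z := (β b)⁻¹ * β (a + b) with hz
  have z_mem : z ∈ F.M.U F.o := mul_mem (inv_mem (β_mem hb)) (β_mem hab)
  have z_smul : z • F.i = (β b)⁻¹ • (a + b).pt := by rw [hz, mul_smul, β_smul_i hab]
  have z_inv_smul : z⁻¹ • F.i = (β (a + b))⁻¹ • b.pt := by
    rw [hz, mul_inv_rev, inv_inv, mul_smul, β_smul_i hb]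
  have not_rel_z : ¬ F.M.rel (z • F.i) F.i := by
    rwa [z_smul, ← rel_smul_smul_iff (β b), smul_inv_smul, β_smul_i hb, rel_pt_iff,
      add_sub_cancel_right]
  have not_rel_z_inv : ¬ F.M.rel (z⁻¹ • F.i) F.i := by
    rw [← rel_smul_smul_iff z, smul_inv_smul]
    exact fun h => not_rel_z (F.M.rel.symm' h)
  have act_b : act (μ b) a = toR F (z • F.i) + b := by
    apply R.ext
    rw [(isSwap_μ hb).pt_act ha, pt_add, pt_toR not_rel_z, z_smul, μ_eq' hb, mul_smul, ← pt_add,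
      mul_smul]
  have act_add_neg : act (μ (a + b)) (-a) = toR F (z⁻¹ • F.i) + (a + b) := by
    apply R.ext
    rw [(isSwap_μ hab).pt_act ha.neg, pt_add, pt_toR not_rel_z_inv, z_inv_smul, μ_eq' hab,
      mul_smul, ← pt_add, mul_smul, neg_add_cancel_left]
  rw [(isSwap_μ hab).act_neg ha, toR_inv_smul_i z_mem not_rel_z] at act_add_neg
  rw [act_b, add_sub_assoc, add_sub_cancel_right, ← neg_inj, act_add_neg]
  simp only [neg_add_rev, neg_sub, sub_neg_eq_add]

variable [F.HasUnitDoubles]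

theorem β_double_mul_self {a : F.R} (ha : a.IsUnitPt) : β (2 • a) * β (2 • a) = β a := by
  have haa : (a + a).IsUnitPt := two_nsmul a ▸ ha.double
  have act_neg_eq : act (μ (a + a)) (-a) = a + a + (a + a) := by
    rw [(isSwap_μ haa).act_neg ha, act_μ_add ha ha haa, act_μ_self ha]
    simp only [neg_add_rev, neg_neg, sub_eq_add_neg, add_assoc]
  have h := congrArg R.pt act_neg_eq
  rw [(isSwap_μ haa).pt_act ha.neg, μ_eq' haa, mul_smul, ← pt_add, mul_smul, pt_add (a + a),
    smul_left_cancel_iff, neg_add_cancel_left, inv_smul_eq_iff] at h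
  rw [two_nsmul]
  refine eq_β (mul_mem (β_mem haa) (β_mem haa)) ?_
  rw [mul_smul, β_smul_i haa, ← h]

theorem IsSwap.two_nsmul_act_double {m : F.Sym} (h : IsSwap m) {a : F.R} (ha : a.IsUnitPt) :
    2 • act m (2 • a) = act m a := by
  apply α_injective
  rw [two_nsmul, α_add, ← h.conj_β ha, ← h.conj_β ha.double, ← β_double_mul_self ha]
  group

end Special

section Double

variable [F.IsAbelian]

instance : AddCommGroup F.R where
  add_comm x y := α_injective (by
    rw [α_add, α_add, IsAbelian.mul_comm _ (α_mem y) _ (α_mem x)])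

variable [F.IsSpecial] [F.HasUnitDoubles]

theorem eq_zero_of_two_nsmul_eq_zero {x : F.R} (hx : 2 • x = 0) : x = 0 := by
  have hx' : x ∈ zeroClass F := by
    refine not_isUnitPt_iff.1 fun hU => hU.double ?_
    rw [hx, pt_zero]
  obtain ⟨u, hu⟩ := F.exists_isUnitPt
  have hm := isSwap_μ hu
  have hux := hu.add_zeroClass hx'
  have act_eq : act (μ u) (u + x) = act (μ u) u := by
    rw [← hm.two_nsmul_act_double hux, smul_add, hx, add_zero, hm.two_nsmul_act_double hu]
  have pt_eq := congrArg R.pt act_eq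
  rw [hm.pt_act hux, hm.pt_act hu, smul_left_cancel_iff] at pt_eq
  exact add_eq_left.1 (R.ext pt_eq)

theorem double_bijective (F : Based X) [F.IsAbelian] [F.IsSpecial] [F.HasUnitDoubles] :
    Function.Bijective (nsmulAddMonoidHom 2 : F.R →+ F.R) := by
  refine ⟨(injective_iff_map_eq_zero _).2 fun x => eq_zero_of_two_nsmul_eq_zero, ?_⟩
  rw [← AddMonoidHom.range_eq_top, eq_top_iff, ← F.closure_isUnitPt_eq_top,
    AddSubgroup.closure_le]
  intro x hx
  obtain ⟨u, hu⟩ := F.exists_isUnitPt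
  have hm := isSwap_μ hu
  refine ⟨act (μ u)⁻¹ (2 • act (μ u) x), ?_⟩
  rw [nsmulAddMonoidHom_apply, hm.inv.two_nsmul_act_double (hm.isUnitPt_act hx), act,
    hm.pt_act hx, inv_smul_smul, toR_pt]

/-- Multiplication by `1/2` on `R`. -/
def halve (F : Based X) [F.IsAbelian] [F.IsSpecial] [F.HasUnitDoubles] : F.R ≃+ F.R :=
  (AddEquiv.ofBijective (nsmulAddMonoidHom 2) (double_bijective F)).symm

theorem two_nsmul_halve (x : F.R) : 2 • halve F x = x :=
  (halve F).symm_apply_apply x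

theorem halve_two_nsmul (x : F.R) : halve F (2 • x) = x :=
  (halve F).apply_symm_apply x

theorem two_nsmul_injective {x y : F.R} (h : 2 • x = 2 • y) : x = y :=
  (double_bijective F).1 h

theorem map_halve (f : AddMonoid.End F.R) (x : F.R) : f (halve F x) = halve F (f x) :=
  two_nsmul_injective (by rw [← map_nsmul, two_nsmul_halve, two_nsmul_halve])

end Double

section MuSquared

theorem μ_mul_μ_comm [F.HasCommHua] {a b c d : F.R} (ha : a.IsUnitPt) (hb : b.IsUnitPt)
    (hc : c.IsUnitPt) (hd : d.IsUnitPt) : μ a * μ b * (μ c * μ d) = μ c * μ d * (μ a * μ b) := by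
  have mem : ∀ {x y : F.R}, x.IsUnitPt → y.IsUnitPt → μ x * μ y ∈ F.M.huaSubgroup F.o F.i :=
    fun {x y} hx hy =>
      Subgroup.subset_closure ⟨y.pt, x.pt, isUnitPt_pt_iff.2 hy, isUnitPt_pt_iff.2 hx, rfl⟩
  exact HasCommHua.mul_comm _ (mem ha hb) _ (mem hc hd)

variable [F.IsAbelian] [F.HasUnitDoubles]

theorem R.IsUnitPt.add_or_sub {b : F.R} (hb : b.IsUnitPt) (c : F.R) :
    (b + c).IsUnitPt ∨ (b - c).IsUnitPt := by
  by_contra! h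
  refine hb.double ?_
  have := add_mem (not_isUnitPt_iff.1 h.1) (not_isUnitPt_iff.1 h.2)
  rwa [add_add_sub_cancel, ← two_nsmul] at this

variable [F.IsSpecial]

theorem torus_smul_eq_self {z : torus F} {b : F.R} (hb : b.IsUnitPt) (hzb : z • b = b)
    (hz : ∀ d : F.R, d.IsUnitPt → z • act (μ d) b = act (μ d) b) (x : F.R) : z • x = x := by
  have fixes_of_add : ∀ d : F.R, d.IsUnitPt → (b + d).IsUnitPt → z • d = d := by
    intro d hd hbd
    have h := hz _ hbd
    rw [act_μ_add hb hd hbd, smul_sub, smul_add, hz d hd, smul_sub, smul_neg, hzb] at h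
    apply two_nsmul_injective
    rw [← sub_eq_zero] at h ⊢
    rw [← neg_eq_zero, ← h]
    abel
  have fixes_unit : ∀ c : F.R, c.IsUnitPt → z • c = c := by
    intro c hc
    rcases hb.add_or_sub c with h | h
    · exact fixes_of_add c hc h
    · rw [← neg_inj, ← smul_neg]
      exact fixes_of_add (-c) hc.neg (by rwa [← sub_eq_add_neg])
  have hx : x ∈ AddSubgroup.closure {x : F.R | x.IsUnitPt} := by
    rw [closure_isUnitPt_eq_top]
    exact AddSubgroup.mem_top x
  induction hx using AddSubgroup.closure_induction with
  | mem c hc => exact fixes_unit c hc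
  | zero => exact smul_zero z
  | add c d _ _ hc hd => rw [smul_add, hc, hd]
  | neg c _ hc => rw [smul_neg, hc]

variable [F.HasCommHua]

theorem μ_mul_self {b : F.R} (hb : b.IsUnitPt) : μ b * μ b = 1 := by
  have hm := isSwap_μ hb
  let z : torus F := ⟨μ b * μ b, hm.mul_mem_torus hm⟩
  have z_smul_b : z • b = b := by
    apply R.ext
    rw [pt_torus_smul, mul_smul, μ_smul_self hb, μ_smul_neg hb]
  have z_smul_act : ∀ d : F.R, d.IsUnitPt → z • act (μ d) b = act (μ d) b := by
    intro d hd
    have neg_act_eq : (-act (μ d) b).pt = (μ d * μ b) • b.pt := by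
      rw [mul_smul, μ_smul_self hb, ← (isSwap_μ hd).act_neg hb, (isSwap_μ hd).pt_act hb.neg]
    rw [← neg_inj, ← smul_neg]
    apply R.ext
    rw [pt_torus_smul, neg_act_eq, ← mul_smul, μ_mul_μ_comm hb hb hd hb, mul_smul,
      ← pt_torus_smul z, z_smul_b]
  have smul_eq_of_not_rel : ∀ p, ¬ F.M.rel p F.i → (μ b * μ b) • p = p := fun p hp =>
    congrArg R.pt (torus_smul_eq_self hb z_smul_b z_smul_act (R.mk p hp))
  refine Subtype.ext (Equiv.ext fun p => ?_)
  by_cases hp : F.M.rel p F.i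
  · have hq : ¬ F.M.rel (μ b • p) F.i := by
      rw [hm.rel_i]
      exact fun h => F.not_rel (F.M.rel.trans' (F.M.rel.symm' h) hp)
    have h := smul_eq_of_not_rel _ hq
    rwa [← mul_smul, mul_assoc, mul_smul, smul_left_cancel_iff] at h
  · exact smul_eq_of_not_rel p hp

theorem μ_smul_μ_smul {b : F.R} (hb : b.IsUnitPt) (p : X) : μ b • μ b • p = p := by
  rw [← mul_smul, μ_mul_self hb, one_smul]

theorem μ_neg_eq {b : F.R} (hb : b.IsUnitPt) : μ (-b) = μ b := by
  rw [μ_neg hb, inv_eq_iff_mul_eq_one, μ_mul_self hb]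

end MuSquared

/-- The choice of a unit `e`, which is written as `1` in `R`. -/
class Unital (F : Based X) extends One F.R where
  isUnitPt_one : (1 : F.R).IsUnitPt

section HuaMaps

variable [F.Unital]

theorem isUnitPt_one : (1 : F.R).IsUnitPt := Unital.isUnitPt_one

theorem isUnitPt_one_add {y : F.R} (hy : ¬ y.IsUnitPt) : (1 + y).IsUnitPt :=
  isUnitPt_one.add_zeroClass (not_isUnitPt_iff.1 hy)

variable [F.IsAbelian]

/-- The Hua map `h_y = μ_e μ_y` as an endomorphism of `R`, for a unit `y`; the junk value at a
nonunit is `0`. -/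
def huaEnd (y : F.R) : AddMonoid.End F.R :=
  open Classical in
  if hy : y.IsUnitPt then
    DistribMulAction.toAddMonoidEnd (torus F) F.R
      ⟨μ y * μ 1, (isSwap_μ hy).mul_mem_torus (isSwap_μ isUnitPt_one)⟩
  else 0

theorem huaEnd_of_not_isUnitPt {y : F.R} (hy : ¬ y.IsUnitPt) : huaEnd y = 0 := dif_neg hy

theorem pt_huaEnd {y : F.R} (hy : y.IsUnitPt) (x : F.R) :
    (huaEnd y x).pt = μ y • μ (1 : F.R) • x.pt := by
  rw [huaEnd, dif_pos hy, ← mul_smul]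
  rfl

theorem huaEnd_mem_zeroClass (y : F.R) {x : F.R} (hx : x ∈ zeroClass F) :
    huaEnd y x ∈ zeroClass F := by
  by_cases hy : y.IsUnitPt
  · rw [huaEnd, dif_pos hy]
    exact torus_smul_mem_zeroClass _ hx
  · rw [huaEnd_of_not_isUnitPt hy]
    exact zero_mem _

theorem huaEnd_commute [F.HasCommHua] (y z : F.R) : Commute (huaEnd y) (huaEnd z) := by
  by_cases hy : y.IsUnitPt
  · by_cases hz : z.IsUnitPt
    · ext x
      apply R.ext
      change (huaEnd y (huaEnd z x)).pt = (huaEnd z (huaEnd y x)).pt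
      simp only [pt_huaEnd hy, pt_huaEnd hz, ← mul_smul]
      rw [← mul_assoc, μ_mul_μ_comm hy isUnitPt_one hz isUnitPt_one, mul_assoc]
    · rw [huaEnd_of_not_isUnitPt hz]
      exact Commute.zero_right _
  · rw [huaEnd_of_not_isUnitPt hy]
    exact Commute.zero_left _

variable [F.IsSpecial]

theorem huaEnd_one_right {y : F.R} (hy : y.IsUnitPt) :
    huaEnd y 1 = -act (μ y) 1 := by
  apply R.ext
  rw [pt_huaEnd hy, μ_smul_self isUnitPt_one, ← (isSwap_μ hy).act_neg isUnitPt_one,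
    (isSwap_μ hy).pt_act isUnitPt_one.neg]

theorem huaEnd_one_add {y : F.R} (hy : y.IsUnitPt) (hy' : (1 + y).IsUnitPt) :
    huaEnd (1 + y) 1 = huaEnd y 1 + 1 + 2 • y := by
  rw [huaEnd_one_right hy, huaEnd_one_right hy', act_μ_add isUnitPt_one hy hy']
  abel

variable [F.HasUnitDoubles] [F.HasCommHua]

theorem huaEnd_one_left : huaEnd (1 : F.R) = 1 := by
  ext x
  apply R.ext
  rw [pt_huaEnd isUnitPt_one, μ_smul_μ_smul isUnitPt_one]
  rfl

theorem huaEnd_neg {y : F.R} (hy : y.IsUnitPt) : huaEnd (-y) = huaEnd y := by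
  ext x
  apply R.ext
  rw [pt_huaEnd hy, pt_huaEnd hy.neg, μ_neg_eq hy]

theorem huaEnd_neg_one_add {y : F.R} (hy : y.IsUnitPt) (hy' : (-1 + y).IsUnitPt) :
    huaEnd (-1 + y) 1 = huaEnd y 1 + 1 - 2 • y := by
  have neg_eq : -(-1 + y) = 1 + -y := by abel
  rw [← huaEnd_neg hy', neg_eq, huaEnd_one_add hy.neg (neg_eq ▸ hy'.neg), huaEnd_neg hy]
  abel

end HuaMaps

section MulEnd

variable [F.Unital] [F.IsAbelian]

/-- The map `R_y` as an endomorphism of `R`. -/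
def mulEnd (y : F.R) : AddMonoid.End F.R :=
  open Classical in
  if y.IsUnitPt then
    if (y + 1).IsUnitPt then huaEnd (1 + y) - huaEnd y - 1
    else -huaEnd (F := F) (-1 + y) + 1 + huaEnd y
  else huaEnd (2 • 1 + y) - huaEnd (1 + y) - huaEnd (-(2 • 1)) + 1

/-- The ring generated by the Hua maps. -/
def huaRing (F : Based X) [F.Unital] [F.IsAbelian] : Subring (AddMonoid.End F.R) :=
  Subring.closure (Set.range huaEnd)

theorem huaEnd_mem_huaRing (y : F.R) : huaEnd y ∈ huaRing F :=
  Subring.subset_closure ⟨y, rfl⟩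

theorem mulEnd_mem_huaRing (y : F.R) : mulEnd y ∈ huaRing F := by
  have h := huaEnd_mem_huaRing (F := F)
  have one_mem := one_mem (huaRing F)
  unfold mulEnd
  split_ifs
  · exact sub_mem (sub_mem (h _) (h _)) one_mem
  · exact add_mem (add_mem (neg_mem (h _)) one_mem) (h _)
  · exact add_mem (sub_mem (sub_mem (h _) (h _)) (h _)) one_mem

theorem map_mem_zeroClass {f : AddMonoid.End F.R} (hf : f ∈ huaRing F) {x : F.R}
    (hx : x ∈ zeroClass F) : f x ∈ zeroClass F := by
  induction hf using Subring.closure_induction generalizing x with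
  | mem f hf =>
    obtain ⟨y, rfl⟩ := hf
    exact huaEnd_mem_zeroClass y hx
  | zero => exact zero_mem _
  | one => exact hx
  | add _ _ _ _ hf hg => exact add_mem (hf hx) (hg hx)
  | neg _ _ hf => exact neg_mem (hf hx)
  | mul _ _ _ _ hf hg => exact hf (hg hx)

theorem commute_of_mem_huaRing [F.HasCommHua] {f g : AddMonoid.End F.R} (hf : f ∈ huaRing F)
    (hg : g ∈ huaRing F) : Commute f g := by
  have huaRing_le : huaRing F ≤ Subring.centralizer (Set.range (huaEnd (F := F))) := by
    refine Subring.closure_le.2 ?_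
    rintro _ ⟨y, rfl⟩ _ ⟨z, rfl⟩
    exact huaEnd_commute z y
  exact Subring.closure_le_centralizer_centralizer _ hg f (huaRing_le hf)

variable [F.HasUnitDoubles]

theorem isUnitPt_neg_one_add {y : F.R} (hy : ¬ (y + 1).IsUnitPt) : (-1 + y).IsUnitPt := by
  have h := isUnitPt_one.double.neg.add_zeroClass (not_isUnitPt_iff.1 hy)
  rwa [show -(2 • 1) + (y + 1) = -1 + y by abel] at h

theorem isUnitPt_two_add {y : F.R} (hy : ¬ y.IsUnitPt) : (2 • 1 + y).IsUnitPt :=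
  isUnitPt_one.double.add_zeroClass (not_isUnitPt_iff.1 hy)

theorem pt_mulEnd (y x : F.R) :
    (mulEnd y x).pt = F.M.Rmap F.o F.i (1 : F.R).pt y.pt x.pt := by
  have hua_smul : ∀ z : F.R, z.IsUnitPt →
      F.M.hua F.o F.i (F.M.mu F.o F.i (1 : F.R).pt) z.pt • x.pt = (huaEnd z x).pt :=
    fun z hz => by rw [pt_huaEnd hz, ← mul_smul]; rfl
  have isUnitPt_iff := isUnitPt_pt_iff (x := y)
  have isUnitPt_add_iff := isUnitPt_pt_iff (x := y + 1)
  rw [pt_add_eq] at isUnitPt_add_iff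
  by_cases hy : y.IsUnitPt
  · by_cases hy' : (y + 1).IsUnitPt
    · rw [mulEnd, if_pos hy, if_pos hy', Data.Rmap, if_pos (isUnitPt_iff.2 hy),
        if_pos (isUnitPt_add_iff.2 hy')]
      simp only [← pt_add_eq, hua_smul _ hy, hua_smul _ (add_comm y 1 ▸ hy'), ← pt_sub_eq]
      rfl
    · rw [mulEnd, if_pos hy, if_neg hy', Data.Rmap, if_pos (isUnitPt_iff.2 hy),
        if_neg (isUnitPt_add_iff.not.2 hy')]
      simp only [← pt_neg_eq, ← pt_add_eq, hua_smul _ hy, hua_smul _ (isUnitPt_neg_one_add hy')]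
      rfl
  · rw [mulEnd, if_neg hy, Data.Rmap, if_neg (isUnitPt_iff.not.2 hy)]
    simp only [← pt_nsmul_eq, ← pt_neg_eq, ← pt_add_eq, hua_smul _ (isUnitPt_two_add hy),
      hua_smul _ (isUnitPt_one_add hy), hua_smul _ isUnitPt_one.double.neg, ← pt_sub_eq]
    rfl

variable [F.IsSpecial] [F.HasCommHua]

theorem mulEnd_one (y : F.R) : mulEnd y 1 = 2 • y := by
  unfold mulEnd
  split_ifs with hy hy'
  · change huaEnd (1 + y) 1 - huaEnd y 1 - 1 = _
    rw [huaEnd_one_add hy (add_comm y 1 ▸ hy')]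
    abel
  · change -huaEnd (-1 + y) 1 + 1 + huaEnd y 1 = _
    rw [huaEnd_neg_one_add hy (isUnitPt_neg_one_add hy')]
    abel
  · have two_add_eq : 2 • 1 + y = 1 + (1 + y) := by abel
    have two_eq : 2 • (1 : F.R) = 1 + 1 := two_nsmul 1
    change huaEnd (2 • 1 + y) 1 - huaEnd (1 + y) 1 - huaEnd (-(2 • 1)) 1 + 1 = _
    rw [two_add_eq,
      huaEnd_one_add (isUnitPt_one_add hy) (two_add_eq ▸ isUnitPt_two_add hy),
      huaEnd_neg isUnitPt_one.double, two_eq,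
      huaEnd_one_add isUnitPt_one (two_eq ▸ isUnitPt_one.double), huaEnd_one_left,
      AddMonoid.End.coe_one, id]
    abel

end MulEnd

section RingStructure

variable [F.IsSpecial] [F.HasUnitDoubles] [F.IsAbelian] [F.Unital]

/-- The map `x ↦ x R_y · (1/2)`. -/
def halfMulEnd (y : F.R) : AddMonoid.End F.R := (halve F : F.R →+ F.R).comp (mulEnd y)

theorem halfMulEnd_apply (y x : F.R) : halfMulEnd y x = halve F (mulEnd y x) := rfl

variable [F.HasCommHua]

theorem commute_halfMulEnd {f : AddMonoid.End F.R} (hf : f ∈ huaRing F) (y : F.R) :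
    Commute f (halfMulEnd y) := by
  ext x
  change f (halve F (mulEnd y x)) = halve F (mulEnd y (f x))
  rw [map_halve]
  exact congrArg (halve F)
    (DFunLike.congr_fun (commute_of_mem_huaRing hf (mulEnd_mem_huaRing y)) x)

theorem halfMulEnd_commute (x y : F.R) : Commute (halfMulEnd x) (halfMulEnd y) := by
  ext z
  change halve F (mulEnd x (halfMulEnd y z)) = halfMulEnd y (halve F (mulEnd x z))
  rw [map_halve]
  exact congrArg (halve F)
    (DFunLike.congr_fun (commute_halfMulEnd (mulEnd_mem_huaRing x) y) z)

theorem halfMulEnd_one (x : F.R) : halfMulEnd x 1 = x := by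
  rw [halfMulEnd_apply, mulEnd_one, halve_two_nsmul]

instance : CommRing F.R := commRingOfCommute halfMulEnd 1 halfMulEnd_commute halfMulEnd_one

theorem mul_def (x y : F.R) : x * y = halfMulEnd y x := rfl

theorem two_nsmul_mul (x y : F.R) : 2 • (x * y) = mulEnd y x := two_nsmul_halve _

theorem pt_mul (x y : F.R) : (x * y).pt = F.M.mul F.o F.i (1 : F.R).pt x.pt y.pt := by
  have exists_half : ∃ z, ¬ F.M.rel z F.i ∧
      F.M.times F.o F.i z 2 = F.M.Rmap F.o F.i (1 : F.R).pt y.pt x.pt :=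
    ⟨(x * y).pt, (x * y).not_rel, by rw [← pt_nsmul_eq, two_nsmul_mul, pt_mulEnd]⟩
  rw [Data.mul, Data.half, dif_pos exists_half]
  obtain ⟨not_rel, times_eq⟩ := exists_half.choose_spec
  refine congrArg R.pt (a₂ := R.mk _ not_rel) (two_nsmul_injective (R.ext ?_))
  rw [two_nsmul_mul, pt_mulEnd, pt_nsmul_eq, R.pt_mk, times_eq]

theorem isConstructedRing :
    @Data.IsConstructedRing X F.M F.o F.i (1 : F.R).pt (inferInstanceAs (CommRing F.R)) :=
  @Data.IsConstructedRing.mk X F.M F.o F.i (1 : F.R).pt (inferInstanceAs (CommRing F.R))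
    pt_add_eq pt_mul pt_zero rfl

theorem apply_eq_apply_one_mul {f : AddMonoid.End F.R} (hf : f ∈ huaRing F) (x : F.R) :
    f x = f 1 * x := by
  rw [mul_def]
  nth_rw 1 [← halfMulEnd_one x]
  exact DFunLike.congr_fun (commute_halfMulEnd hf x) 1

theorem mul_act_μ_one_of_one_add {a : F.R} (ha : a.IsUnitPt) (ha' : (1 + a).IsUnitPt) :
    a * act (μ 1) a = -1 := by
  have huaEnd_one_mul : ∀ {b : F.R}, b.IsUnitPt →
      huaEnd b 1 * act (μ 1) a = act (μ b) a := by
    intro b hb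
    rw [← apply_eq_apply_one_mul (huaEnd_mem_huaRing b)]
    apply R.ext
    rw [pt_huaEnd hb, (isSwap_μ isUnitPt_one).pt_act ha, μ_smul_μ_smul isUnitPt_one,
      (isSwap_μ hb).pt_act ha]
  have h_self := huaEnd_one_mul ha
  have h_add := huaEnd_one_mul ha'
  rw [act_μ_self ha] at h_self
  rw [huaEnd_one_add ha ha', add_comm 1 a,
    act_μ_add ha isUnitPt_one (add_comm 1 a ▸ ha')] at h_add
  apply two_nsmul_injective
  linear_combination h_add - h_self

theorem mul_act_μ_one {a : F.R} (ha : a.IsUnitPt) : a * act (μ 1) a = -1 := by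
  rcases isUnitPt_one.add_or_sub a with h | h
  · exact mul_act_μ_one_of_one_add ha h
  · rw [← mul_act_μ_one_of_one_add ha.neg (sub_eq_add_neg 1 a ▸ h),
      (isSwap_μ isUnitPt_one).act_neg ha, neg_mul_neg]

theorem R.IsUnitPt.isUnit {a : F.R} (ha : a.IsUnitPt) : IsUnit a :=
  IsUnit.of_mul_eq_one (-act (μ 1) a) (by rw [mul_neg, mul_act_μ_one ha, neg_neg])

theorem mul_mem_zeroClass {a : F.R} (ha : a ∈ zeroClass F) (b : F.R) : a * b ∈ zeroClass F := by
  refine not_isUnitPt_iff.1 fun h => h.double ?_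
  rw [two_nsmul_mul]
  exact map_mem_zeroClass (mulEnd_mem_huaRing b) ha

theorem isUnit_iff_isUnitPt {a : F.R} : IsUnit a ↔ a.IsUnitPt := by
  refine ⟨fun h => ?_, R.IsUnitPt.isUnit⟩
  obtain ⟨b, hb⟩ := h.exists_right_inv
  exact fun ha => isUnitPt_one (hb ▸ mul_mem_zeroClass ha b)

instance : IsLocalRing F.R :=
  haveI : Nontrivial F.R :=
    ⟨1, 0, fun h => isUnitPt_one (F := F) (h ▸ zero_mem (zeroClass F))⟩
  .of_isUnit_or_isUnit_one_sub_self fun a => by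
    simp only [isUnit_iff_isUnitPt, or_iff_not_imp_left]
    intro ha
    exact sub_eq_add_neg 1 a ▸
      isUnitPt_one.add_zeroClass (neg_mem (not_isUnitPt_iff.1 ha))

theorem mem_maximalIdeal_iff {a : F.R} :
    a ∈ IsLocalRing.maximalIdeal F.R ↔ a ∈ zeroClass F := by
  rw [IsLocalRing.mem_maximalIdeal, mem_nonunits_iff, isUnit_iff_isUnitPt, not_isUnitPt_iff]

end RingStructure

section Projective

theorem rel_μ_one_smul_pt [F.Unital] {x : F.R} (hx : x ∈ zeroClass F) :
    F.M.rel (μ (1 : F.R) • x.pt) F.i :=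
  ((isSwap_μ isUnitPt_one).rel_i _).2 hx

variable [F.IsSpecial] [F.HasUnitDoubles] [F.IsAbelian] [F.Unital] [F.HasCommHua]

theorem exists_α_smul_μ_one_smul_eq (hstar : F.M.StarIdentity F.o F.i (1 : F.R).pt) {x : F.R}
    (hx : x ∈ zeroClass F) (y : F.R) :
    ∃ u ∈ zeroClass F, (1 - x * y) * u = x ∧ α y • μ (1 : F.R) • x.pt = μ (1 : F.R) • u.pt := by
  set w : F.R := -(2 • 1) + mulEnd x y with hw
  have hwx : w = -2 + 2 * (x * y) := by
    rw [hw, ← two_nsmul_mul, two_nsmul, two_nsmul]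
    ring
  have isUnitPt_w : w.IsUnitPt := by
    rw [hw, ← two_nsmul_mul, mul_comm y]
    exact isUnitPt_one.double.neg.add_zeroClass (nsmul_mem (mul_mem_zeroClass hx y) 2)
  have mul_act_w := mul_act_μ_one isUnitPt_w
  refine ⟨mulEnd x (act (μ 1) w), ?_, ?_, ?_⟩
  · rw [← two_nsmul_mul, mul_comm]
    exact nsmul_mem (mul_mem_zeroClass hx _) 2
  · rw [← two_nsmul_mul, two_nsmul]
    linear_combination (-x) * mul_act_w + x * act (μ 1) w * hwx
  · have h := hstar x.pt y.pt hx y.not_rel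
    rw [← pt_nsmul_eq, ← pt_neg_eq] at h
    rw [pt_mulEnd, (isSwap_μ isUnitPt_one).pt_act isUnitPt_w, hw, add_comm, pt_add, pt_mulEnd]
    exact h

theorem exists_eq_pt_or_exists_eq_μ_one_smul_pt (p : X) :
    (∃ x : F.R, p = x.pt) ∨ ∃ x ∈ zeroClass F, p = μ (1 : F.R) • x.pt := by
  by_cases hp : F.M.rel p F.i
  · have hq : F.M.rel (μ (1 : F.R) • p) F.o := ((isSwap_μ isUnitPt_one).rel_o p).2 hp
    have hq' : ¬ F.M.rel (μ (1 : F.R) • p) F.i := fun h =>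
      F.not_rel (F.M.rel.trans' (F.M.rel.symm' hq) h)
    exact Or.inr ⟨R.mk _ hq', hq, (μ_smul_μ_smul isUnitPt_one p).symm⟩
  · exact Or.inl ⟨R.mk p hp, rfl⟩

/-- The map `X → ℙ¹(R)` that sends a point `x` of `R` to `[1, x]`, and the image under `μ_e` of a
point `x` of the class of `0` to `[x, -1]`. -/
def toP1 (p : X) : P1 F.R :=
  open Classical in
  if F.M.rel p F.i then P1.coaffine (toR F (μ (1 : F.R) • p)) else P1.affine (toR F p)

theorem toP1_pt (x : F.R) : toP1 x.pt = P1.affine x := by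
  rw [toP1, if_neg x.not_rel, toR_pt]

theorem toP1_μ_one_smul_pt {x : F.R} (hx : x ∈ zeroClass F) :
    toP1 (μ (1 : F.R) • x.pt) = P1.coaffine x := by
  rw [toP1, if_pos (rel_μ_one_smul_pt hx), μ_smul_μ_smul isUnitPt_one, toR_pt]

theorem toP1_i : toP1 F.i = P1.infinity F.R := by
  rw [← P1.coaffine_zero, ← toP1_μ_one_smul_pt (zero_mem _), pt_zero,
    (isSwap_μ isUnitPt_one).smul_o]

theorem toP1_μ_one_smul (p : X) :
    toP1 (μ (1 : F.R) • p) = slMap (tauMatrix F.R) (toP1 p) := by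
  obtain ⟨x, rfl⟩ | ⟨x, hx, rfl⟩ := exists_eq_pt_or_exists_eq_μ_one_smul_pt (F := F) p
  · rw [toP1_pt, slMap_tauMatrix_affine]
    by_cases hx : x.IsUnitPt
    · obtain ⟨u, hu⟩ := hx.isUnit
      rw [← (isSwap_μ isUnitPt_one).pt_act hx, toP1_pt]
      exact (P1.mk_eq_mk_iff _ _).2 ⟨u, by rw [hu, mul_one], by rw [hu, mul_act_μ_one hx]⟩
    · exact toP1_μ_one_smul_pt (not_isUnitPt_iff.1 hx)
  · rw [μ_smul_μ_smul isUnitPt_one, toP1_μ_one_smul_pt hx, toP1_pt, slMap_tauMatrix_coaffine]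

theorem toP1_α_smul (hstar : F.M.StarIdentity F.o F.i (1 : F.R).pt) (y : F.R) (p : X) :
    toP1 (α y • p) = slMap (upperMatrix y) (toP1 p) := by
  obtain ⟨x, rfl⟩ | ⟨x, hx, rfl⟩ := exists_eq_pt_or_exists_eq_μ_one_smul_pt (F := F) p
  · rw [← pt_add, toP1_pt, toP1_pt, slMap_upperMatrix_affine]
  · obtain ⟨u, hu, hxu, h⟩ := exists_α_smul_μ_one_smul_eq hstar hx y
    have isUnit_one_sub : IsUnit (1 - x * y) := by
      rw [isUnit_iff_isUnitPt, sub_eq_add_neg]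
      exact isUnitPt_one.add_zeroClass (neg_mem (mul_mem_zeroClass hx y))
    rw [h, toP1_μ_one_smul_pt hu, toP1_μ_one_smul_pt hx,
      slMap_upperMatrix_coaffine y isUnit_one_sub hxu]

theorem rel_toP1_iff (p q : X) : F.M.rel p q ↔ P1.rel F.R (toP1 p) (toP1 q) := by
  have not_rel {x y : F.R} (hy : y ∈ zeroClass F) : ¬ F.M.rel x.pt (μ (1 : F.R) • y.pt) := fun h =>
    x.not_rel (F.M.rel.trans' h (rel_μ_one_smul_pt hy))
  obtain ⟨x, rfl⟩ | ⟨x, hx, rfl⟩ := exists_eq_pt_or_exists_eq_μ_one_smul_pt (F := F) p <;>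
  obtain ⟨y, rfl⟩ | ⟨y, hy, rfl⟩ := exists_eq_pt_or_exists_eq_μ_one_smul_pt (F := F) q
  · rw [toP1_pt, toP1_pt, P1.affine, P1.affine, P1.rel_affine, rel_pt_iff, mem_maximalIdeal_iff]
  · rw [toP1_pt, toP1_μ_one_smul_pt hy]
    exact iff_of_false (not_rel hy) (P1.not_rel_affine_coaffine x (mem_maximalIdeal_iff.2 hy))
  · rw [toP1_pt, toP1_μ_one_smul_pt hx]
    exact iff_of_false (fun h => not_rel hx (F.M.rel.symm' h)) fun h =>
      P1.not_rel_affine_coaffine y (mem_maximalIdeal_iff.2 hx) ((P1.rel F.R).symm' h)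
  · rw [toP1_μ_one_smul_pt hx, toP1_μ_one_smul_pt hy]
    exact iff_of_true
      (F.M.rel.trans' (rel_μ_one_smul_pt hx) (F.M.rel.symm' (rel_μ_one_smul_pt hy)))
      (P1.rel_coaffine_coaffine (mem_maximalIdeal_iff.2 hx) (mem_maximalIdeal_iff.2 hy))

theorem toP1_injective : Function.Injective (toP1 (F := F)) := by
  intro p q h
  have ne {x y : F.R} (hy : y ∈ zeroClass F) : P1.affine x ≠ P1.coaffine y := fun h =>
    P1.not_rel_affine_coaffine x (mem_maximalIdeal_iff.2 hy) (h ▸ (P1.rel F.R).refl' _)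
  obtain ⟨x, rfl⟩ | ⟨x, hx, rfl⟩ := exists_eq_pt_or_exists_eq_μ_one_smul_pt (F := F) p <;>
  obtain ⟨y, rfl⟩ | ⟨y, hy, rfl⟩ := exists_eq_pt_or_exists_eq_μ_one_smul_pt (F := F) q
  · rw [toP1_pt, toP1_pt] at h
    rw [P1.affine_injective h]
  · rw [toP1_pt, toP1_μ_one_smul_pt hy] at h
    exact (ne hy h).elim
  · rw [toP1_pt, toP1_μ_one_smul_pt hx] at h
    exact (ne hx h.symm).elim
  · rw [toP1_μ_one_smul_pt hx, toP1_μ_one_smul_pt hy] at h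
    rw [P1.coaffine_injective h]

theorem toP1_surjective : Function.Surjective (toP1 (F := F)) := by
  intro p
  obtain ⟨x, rfl⟩ | ⟨x, hx, rfl⟩ := p.exists_eq_affine_or_exists_eq_coaffine
  · exact ⟨x.pt, toP1_pt x⟩
  · exact ⟨μ (1 : F.R) • x.pt, toP1_μ_one_smul_pt (mem_maximalIdeal_iff.1 hx)⟩

/-- The bijection from `X` to `ℙ¹(R)` as an equivalence. -/
def equivP1 (F : Based X) [F.IsSpecial] [F.HasUnitDoubles] [F.IsAbelian] [F.Unital]
    [F.HasCommHua] : X ≃ P1 F.R :=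
  Equiv.ofBijective toP1 ⟨toP1_injective, toP1_surjective⟩

theorem symEquiv_equivP1_eq {g : F.Sym} {A : SL(2, F.R)}
    (h : ∀ p, toP1 (g • p) = slMap A (toP1 p)) :
    symEquiv (equivP1 F) rel_toP1_iff g = (slHom A).unop := by
  refine Subtype.ext (Equiv.ext fun q => ?_)
  obtain ⟨p, rfl⟩ := (equivP1 F).surjective q
  exact (symEquiv_smul (equivP1 F) rel_toP1_iff g p).trans (h p)

theorem map_root_i_eq_translations (hstar : F.M.StarIdentity F.o F.i (1 : F.R).pt) :
    (F.M.U F.i).map (symEquiv (equivP1 F) rel_toP1_iff).toMonoidHom = translations F.R := by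
  ext g
  rw [mem_translations_iff]
  constructor
  · rintro ⟨k, hk, rfl⟩
    have hko : ¬ F.M.rel (k • F.o) F.i :=
      (F.isLocalMoufangSet.rel_smul_iff_of_mem hk _).not.2 F.not_rel
    have hkα : k = α (R.mk _ hko) := eq_α hk rfl
    exact ⟨_, (congrArg _ hkα).trans (symEquiv_equivP1_eq (toP1_α_smul hstar _))⟩
  · rintro ⟨r, rfl⟩
    exact ⟨α r, α_mem r, symEquiv_equivP1_eq (toP1_α_smul hstar r)⟩

theorem isomorphic_projective (hstar : F.M.StarIdentity F.o F.i (1 : F.R).pt) :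
    Isomorphic F.M (projective F.R) := by
  have hμ := isSwap_μ (isUnitPt_one (F := F))
  refine isomorphic_of_map_root F.isLocalMoufangSet (projective_isLocalMoufangSet F.R)
    (equivP1 F) rel_toP1_iff (i := F.i) ?_ hμ.mem ?_ ?_
  · exact (map_root_i_eq_translations hstar).trans
      (projective_U_infinity.symm.trans (congrArg _ toP1_i.symm))
  · rw [hμ.smul_i]
    exact F.not_rel
  · intro p
    have h := symEquiv_equivP1_eq (F := F) toP1_μ_one_smul
    exact h ▸ conjBy_projective_U (tauMatrix F.R) p

end Projective

end Based

end LocalMoufang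

end

theorem mainTheorem7 {X : Type u} (M : LocalMoufang.Data X) (hM : M.IsLocalMoufangSet)
    (o i : X) (hoi : ¬ M.rel o i)
    (t : X) (ht : M.IsUnitPt o i t) (hR : M.SatisfiesR o i (M.mu o i t))
    (e : X) (he : M.IsUnitPt o i e) (hstar : M.StarIdentity o i e) :
    ∃ (_ : CommRing (M.RingCarrier i)) (_ : IsLocalRing (M.RingCarrier i)),
      M.IsConstructedRing o i e ∧
      (LocalMoufang.projective (M.RingCarrier i)).IsLocalMoufangSet ∧
      LocalMoufang.Isomorphic M (LocalMoufang.projective (M.RingCarrier i)) := by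
  let F : LocalMoufang.Based X := ⟨M, hM, o, i, hoi⟩
  have isSwap_μ_t : LocalMoufang.Based.IsSwap (F := F) (M.mu o i t) :=
    LocalMoufang.Based.isSwap_μ (x := .mk t ht.2) ht.1
  have : F.IsSpecial := LocalMoufang.Based.isSpecial_of_tilde_eq_neg isSwap_μ_t hR.R1
  have : F.IsAbelian := ⟨hR.R2⟩
  have : F.HasCommHua := ⟨hR.R3⟩
  have : F.HasUnitDoubles := LocalMoufang.Based.hasUnitDoubles_of_isUnitPt_times_two hR.R4
  let : F.Unital := { one := .mk e he.2, isUnitPt_one := he.1 }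
  exact ⟨(inferInstance : CommRing F.R), (inferInstance : IsLocalRing F.R),
    LocalMoufang.Based.isConstructedRing (F := F),
    LocalMoufang.projective_isLocalMoufangSet F.R,
    LocalMoufang.Based.isomorphic_projective (F := F) hstar⟩
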